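/- Let $F$ be a field, $S=F[x_0,\dots,x_n]$ with the standard grading, and let $M$ be a finitely generated graded $S$-module generated in degree $0$. Let $d\ge 1$ and let $I\subset S$ be an ideal generated by forms of degree $d$. Assume that $M/IM$ has finite length, but $M$ does not. For a graded $S$-module $N$ write $\operatorname{reg} N=\sup\{\,j-i : \operatorname{Tor}_i^S(N,F)_j\neq 0\,\}$ for its Castelnuovo--Mumford regularity. Then there are integers $f_t,e_t$ $(t\ge 1)$ such that 1. $\operatorname{reg}(M/I^tM)=dt+f_t-1$ for all $t\ge 1$, with $f_1\ge f_2\ge\cdots\ge 0$; 2. $\operatorname{reg}(I^tM)=dt+e_t$ for all $t\ge 1$, with $e_1\ge e_2\ge\cdots\ge 0$. Moreover $\inf_{t\ge1} e_t=\inf_{t\ge1} f_t$, and if $e$ denotes this common value, then $\operatorname{reg}(I^tM)=dt+e$ for all $t\gg 0$. -/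

import Mathlib

open MvPolynomial

/-- `ℳ` makes `M` into a `ℤ`-graded module over the standard graded polynomial ring
`S = F[x_0, …, x_{m-1}]`: `M` is the direct sum of the additive subgroups `ℳ j`, and
`S_a • ℳ b ⊆ ℳ (a + b)`. -/
structure IsGradedModule (F : Type*) [Field F] (m : ℕ) {M : Type*} [AddCommGroup M]
    [Module (MvPolynomial (Fin m) F) M] (ℳ : ℤ → AddSubgroup M) : Prop where
  isInternal : DirectSum.IsInternal ℳ
  smul_mem : ∀ (a : ℕ) (b : ℤ) (p : MvPolynomial (Fin m) F) (x : M),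
    p.IsHomogeneous a → x ∈ ℳ b → p • x ∈ ℳ (a + b)

/-- The grading induced on a submodule `N` of `M`: the part of degree `j` is `N ∩ ℳ j`. -/
def subGrading {R M : Type*} [Ring R] [AddCommGroup M] [Module R M]
    (ℳ : ℤ → AddSubgroup M) (N : Submodule R M) (j : ℤ) : AddSubgroup N :=
  (ℳ j).comap N.subtype.toAddMonoidHom

/-- The grading induced on a quotient `M ⧸ N`: the part of degree `j` is the image of `ℳ j`. -/
def quotGrading {R M : Type*} [Ring R] [AddCommGroup M] [Module R M]
    (ℳ : ℤ → AddSubgroup M) (N : Submodule R M) (j : ℤ) : AddSubgroup (M ⧸ N) :=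
  (ℳ j).map N.mkQ.toAddMonoidHom

/-- The differential of the Koszul complex `M ⊗ K(x_0, …, x_{m-1})`. An element
`∑_A c_A ⊗ e_A` of `M ⊗ ⋀ S^m` is given by its coefficients `c : Finset (Fin m) → M`, where
`e_A = e_{a_1} ∧ ⋯ ∧ e_{a_i}` for `A = {a_1 < ⋯ < a_i}`, and
`∂ (e_A) = ∑_{k ∈ A} (-1) ^ #{a ∈ A | a < k} x_k e_{A \ {k}}`. -/
noncomputable def koszulDiff (F : Type*) [Field F] (m : ℕ) (M : Type*) [AddCommGroup M]
    [Module (MvPolynomial (Fin m) F) M] :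
    (Finset (Fin m) → M) →ₗ[MvPolynomial (Fin m) F] (Finset (Fin m) → M) :=
  LinearMap.pi fun A => ∑ k ∈ Aᶜ,
    ((-1) ^ (A.filter (· < k)).card * X k : MvPolynomial (Fin m) F) •
      LinearMap.proj (insert k A)

theorem koszulDiff_apply {F : Type*} [Field F] {m : ℕ} {M : Type*} [AddCommGroup M]
    [Module (MvPolynomial (Fin m) F) M] (c : Finset (Fin m) → M) (A : Finset (Fin m)) :
    koszulDiff F m M c A = ∑ k ∈ Aᶜ,
      ((-1) ^ (A.filter (· < k)).card * X k : MvPolynomial (Fin m) F) • c (insert k A) := by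
  simp [koszulDiff]

/-- The Koszul differential squares to zero. -/
theorem koszulDiff_koszulDiff {F : Type*} [Field F] {m : ℕ} {M : Type*} [AddCommGroup M]
    [Module (MvPolynomial (Fin m) F) M] (c : Finset (Fin m) → M) :
    koszulDiff F m M (koszulDiff F m M c) = 0 := by
  funext A
  simp only [koszulDiff_apply, Finset.smul_sum, Pi.zero_apply, smul_smul]
  rw [Finset.sum_sigma']
  refine Finset.sum_involution (fun p _ => ⟨p.2, p.1⟩) ?_ ?_ ?_ ?_
  · rintro ⟨k, l⟩ h
    simp only [Finset.mem_sigma, Finset.mem_compl, Finset.mem_insert, not_or] at h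
    obtain ⟨hk, hlk, hl⟩ := h
    have key : ∀ a b : Fin m, a ∉ A → a < b →
        ((insert a A).filter (· < b)).card = (A.filter (· < b)).card + 1 ∧
        ((insert b A).filter (· < a)).card = (A.filter (· < a)).card := by
      intro a b ha hab
      rw [Finset.filter_insert, Finset.filter_insert, if_pos hab, if_neg (not_lt.2 hab.le),
        Finset.card_insert_of_notMem (by simp [ha])]
      exact ⟨rfl, rfl⟩
    dsimp only
    rw [Finset.insert_comm k l A, ← add_smul]
    rcases lt_or_gt_of_ne hlk with hlt | hlt
    · rw [(key l k hl hlt).1, (key l k hl hlt).2]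
      convert zero_smul (MvPolynomial (Fin m) F) _ using 2
      ring
    · rw [(key k l hk hlt).1, (key k l hk hlt).2]
      convert zero_smul (MvPolynomial (Fin m) F) _ using 2
      ring
  · rintro ⟨k, l⟩ h _ he
    simp only [Finset.mem_sigma, Finset.mem_compl, Finset.mem_insert, not_or] at h
    simp only [Sigma.mk.injEq] at he
    exact h.2.1 he.1
  · rintro ⟨k, l⟩ h
    simp only [Finset.mem_sigma, Finset.mem_compl, Finset.mem_insert, not_or] at h ⊢
    exact ⟨h.2.2, fun e => h.2.1 e.symm, h.1⟩
  · rintro ⟨k, l⟩ h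
    rfl

/-- The chains of homological degree `i` and internal degree `j` of the Koszul complex of `M`:
the basis element `e_A` has internal degree `#A`. -/
def koszulChains (m : ℕ) {M : Type*} [AddCommGroup M] (ℳ : ℤ → AddSubgroup M) (i : ℕ) (j : ℤ) :
    AddSubgroup (Finset (Fin m) → M) :=
  AddSubgroup.pi Set.univ fun A => if A.card = i then ℳ (j - i) else ⊥

/-- The cycles of homological degree `i` and internal degree `j`. -/
noncomputable def koszulCycles (F : Type*) [Field F] (m : ℕ) {M : Type*} [AddCommGroup M]
    [Module (MvPolynomial (Fin m) F) M] (ℳ : ℤ → AddSubgroup M) (i : ℕ) (j : ℤ) :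
    AddSubgroup (Finset (Fin m) → M) :=
  koszulChains m ℳ i j ⊓ (koszulDiff F m M).toAddMonoidHom.ker

/-- The boundaries of homological degree `i` and internal degree `j`. -/
noncomputable def koszulBoundaries (F : Type*) [Field F] (m : ℕ) {M : Type*} [AddCommGroup M]
    [Module (MvPolynomial (Fin m) F) M] (ℳ : ℤ → AddSubgroup M) (i : ℕ) (j : ℤ) :
    AddSubgroup (Finset (Fin m) → M) :=
  (koszulChains m ℳ (i + 1) j).map (koszulDiff F m M).toAddMonoidHom

/-- `Tor_i^S(M, F)_j`, the part of degree `j` of `Tor_i^S(M, F)`, where `F = S/(x_0, …, x_{m-1})`.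
It is computed with the graded free resolution of `F` over `S` by the Koszul complex. -/
abbrev GradedTor (F : Type*) [Field F] (m : ℕ) {M : Type*} [AddCommGroup M]
    [Module (MvPolynomial (Fin m) F) M] (ℳ : ℤ → AddSubgroup M) (i : ℕ) (j : ℤ) : Type _ :=
  koszulCycles F m ℳ i j ⧸ (koszulBoundaries F m ℳ i j).addSubgroupOf (koszulCycles F m ℳ i j)

/-- The Castelnuovo-Mumford regularity `sup {j - i | Tor_i^S(M, F)_j ≠ 0}` of the graded
`S`-module `M`, that is, the supremum of `j - i` over the degrees `j` of the generators of the
`i`-th module in the minimal graded free resolution of `M`. It is `⊥ = -∞` for `M = 0`. -/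
noncomputable def regularity (F : Type*) [Field F] (m : ℕ) {M : Type*} [AddCommGroup M]
    [Module (MvPolynomial (Fin m) F) M] (ℳ : ℤ → AddSubgroup M) : EReal :=
  ⨆ (i : ℕ) (j : ℤ) (_ : Nontrivial (GradedTor F m ℳ i j)), (((j - i : ℤ) : ℝ) : EReal)

/-!
# Regularity of powers of an ideal

Since `M ⧸ I ^ t M` lives in bounded degrees, its regularity is its top degree: a nonzero element
of top degree is in the socle, and the last Koszul homology is the socle
(`IsGradedModule.regularityLE_iff_of_top`). So `d t + f t` is the first degree in which `M` and
`I ^ t M` agree. If they agree in degree `d t + a`, then `M_{d(t+1)+a} ⊆ I M`, that is,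
`M_{d(t+1)+a} = I_d M_{dt+a}`, which is contained in `I ^ (t+1) M`; hence `f` is decreasing
(`IsGradedModule.le_pow_succ_smul_top`). It is nonnegative because `I ^ t M` starts in degree `d t`
while `M`, which does not have finite length, is nonzero in degree `d t - 1`.

Let `K` be the largest homogeneous submodule of `M` in bounded degrees, `M' = M ⧸ K`, and `f'` the
sequence `f` of `M'`. The module `M'` has no socle, so the long exact sequence of
`0 → I ^ t M' → M' → M' ⧸ I ^ t M' → 0` gives `reg (I ^ t M') = max (reg M') (d t + f' t)`
(`IsGradedModule.regularityLE_subGrading_iff`). The sequence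
`0 → K ∩ I ^ t M → I ^ t M → I ^ t M' → 0` then shows that `reg (I ^ t M)` is the maximum of the top
degree of `K ∩ I ^ t M`, of `reg M'`, and of `d t + f' t`
(`IsGradedModule.regularityLE_subGrading_iff_of_degreeLE`). The first term decreases with `t`, the
second is constant and finite (`IsGradedModule.exists_regularityLE`), and `f'` is decreasing and
nonnegative; so `e` is decreasing and nonnegative, and for large `t` the third term dominates.
Finally `f' ≤ f`, with equality as soon as `d t` exceeds the degrees of `K`. So `e`, `f` and `f'`
are eventually constant with the same value.
-/

/-! ### Projections onto graded pieces -/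

section Grading

variable {F : Type*} [Field F] {m : ℕ} {M : Type*} [AddCommGroup M]
  [Module (MvPolynomial (Fin m) F) M] {ℳ : ℤ → AddSubgroup M}

/-- A form of positive degree is a sum of products of a variable and a form of one degree less. -/
theorem MvPolynomial.IsHomogeneous.mem_closure_X_mul {p : MvPolynomial (Fin m) F} {a : ℕ}
    (hp : p.IsHomogeneous (a + 1)) :
    p ∈ AddSubgroup.closure
      {q | ∃ (k : Fin m) (r : MvPolynomial (Fin m) F), r.IsHomogeneous a ∧ q = X k * r} := by
  rw [p.as_sum]
  refine AddSubgroup.sum_mem _ fun u hu => AddSubgroup.subset_closure ?_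
  have hdeg : u.degree = a + 1 := by
    rw [Finsupp.degree_eq_weight_one]
    exact hp (mem_support_iff.1 hu)
  obtain ⟨k, hk⟩ : ∃ k, u k ≠ 0 := by
    by_contra! h
    have : u = 0 := Finsupp.ext h
    simp [this] at hdeg
  have hle : Finsupp.single k 1 ≤ u := by
    rw [Finsupp.single_le_iff]; omega
  have hu' : u = Finsupp.single k 1 + (u - Finsupp.single k 1) := (add_tsub_cancel_of_le hle).symm
  refine ⟨k, monomial (u - Finsupp.single k 1) (coeff u p), isHomogeneous_monomial _ ?_, ?_⟩
  · rw [hu', map_add, Finsupp.degree_single] at hdeg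
    omega
  · rw [X, monomial_mul, one_mul, ← hu']

namespace IsGradedModule

/-- The projection of a graded module onto its part of degree `j`. -/
noncomputable def proj (h : IsGradedModule F m ℳ) (j : ℤ) : M →+ M :=
  (ℳ j).subtype.comp ((DFinsupp.evalAddMonoidHom j).comp
    (AddEquiv.ofBijective (DirectSum.coeAddMonoidHom ℳ) h.isInternal).symm.toAddMonoidHom)

theorem proj_mem (h : IsGradedModule F m ℳ) (j : ℤ) (x : M) : h.proj j x ∈ ℳ j :=
  SetLike.coe_mem _

theorem proj_of_mem (h : IsGradedModule F m ℳ) {i : ℤ} (j : ℤ) {x : M} (hx : x ∈ ℳ i) :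
    h.proj j x = if i = j then x else 0 := by
  have : (AddEquiv.ofBijective (DirectSum.coeAddMonoidHom ℳ) h.isInternal).symm x
      = DirectSum.of (fun i => ℳ i) i ⟨x, hx⟩ := by
    rw [AddEquiv.symm_apply_eq]
    exact (DirectSum.coeAddMonoidHom_of ℳ i ⟨x, hx⟩).symm
  change (((AddEquiv.ofBijective (DirectSum.coeAddMonoidHom ℳ) h.isInternal).symm x) j : M) = _
  rw [this, DirectSum.coe_of_apply]
  split_ifs <;> rfl

theorem proj_eq_self (h : IsGradedModule F m ℳ) {j : ℤ} {x : M} (hx : x ∈ ℳ j) :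
    h.proj j x = x := by
  rw [h.proj_of_mem j hx, if_pos rfl]

theorem proj_eq_zero (h : IsGradedModule F m ℳ) {i j : ℤ} {x : M} (hx : x ∈ ℳ i) (hij : i ≠ j) :
    h.proj j x = 0 := by
  rw [h.proj_of_mem j hx, if_neg hij]

theorem mem_of_proj_mem (h : IsGradedModule F m ℳ) (N : AddSubgroup M) {x : M}
    (hx : ∀ j, h.proj j x ∈ N) : x ∈ N := by
  classical
  set e := AddEquiv.ofBijective (DirectSum.coeAddMonoidHom ℳ) h.isInternal with he
  have hx' : x = DirectSum.coeAddMonoidHom ℳ (e.symm x) := (e.apply_symm_apply x).symm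
  rw [hx', DirectSum.coeAddMonoidHom_eq_dfinsuppSum]
  exact AddSubgroup.sum_mem _ fun j _ => hx j

theorem eq_zero_of_proj_eq_zero (h : IsGradedModule F m ℳ) {x : M}
    (hx : ∀ j, h.proj j x = 0) : x = 0 :=
  h.mem_of_proj_mem ⊥ hx

/-- Multiplication by a form of degree `a` shifts homogeneous components by `a`. -/
theorem proj_smul (h : IsGradedModule F m ℳ) {a : ℕ} {p : MvPolynomial (Fin m) F}
    (hp : p.IsHomogeneous a) (j : ℤ) (x : M) :
    h.proj j (p • x) = p • h.proj (j - a) x := by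
  let φ : M →+ M := (h.proj j).comp (DistribSMul.toAddMonoidHom M p)
  let ψ : M →+ M := (DistribSMul.toAddMonoidHom M p).comp (h.proj (j - a))
  refine h.mem_of_proj_mem (φ.eqLocus ψ) fun i => ?_
  change h.proj j (p • h.proj i x) = p • h.proj (j - a) (h.proj i x)
  rw [h.proj_of_mem j (h.smul_mem a i p _ hp (h.proj_mem i x)),
    h.proj_of_mem (j - a) (h.proj_mem i x)]
  by_cases hij : a + i = j
  · rw [if_pos hij, if_pos (by omega)]
  · rw [if_neg hij, if_neg (by omega), smul_zero]

theorem proj_smul_eq_sum (h : IsGradedModule F m ℳ) (p : MvPolynomial (Fin m) F) (j : ℤ) (x : M) :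
    h.proj j (p • x) = ∑ a ∈ Finset.range (p.totalDegree + 1),
      homogeneousComponent a p • h.proj (j - a) x := by
  conv_lhs => rw [← p.sum_homogeneousComponent, Finset.sum_smul, map_sum]
  exact Finset.sum_congr rfl fun a _ => h.proj_smul (homogeneousComponent_isHomogeneous a p) j x

theorem X_smul_mem (h : IsGradedModule F m ℳ) (k : Fin m) {j : ℤ} {x : M} (hx : x ∈ ℳ j) :
    (X k : MvPolynomial (Fin m) F) • x ∈ ℳ (j + 1) := by
  have := h.smul_mem 1 j (X k) x (isHomogeneous_X F k) hx
  rwa [Nat.cast_one, add_comm] at this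

/-- A family of additive projections certifies a grading. -/
theorem of_proj (π : ℤ → M →+ M) (hmem : ∀ j x, π j x ∈ ℳ j)
    (hself : ∀ j, ∀ x ∈ ℳ j, π j x = x) (hzero : ∀ i j, i ≠ j → ∀ x ∈ ℳ i, π j x = 0)
    (hgen : ∀ (N : AddSubgroup M) (x : M), (∀ j, π j x ∈ N) → x ∈ N)
    (hsmul : ∀ (a : ℕ) (b : ℤ) (p : MvPolynomial (Fin m) F) (x : M),
      p.IsHomogeneous a → x ∈ ℳ b → p • x ∈ ℳ (a + b)) : IsGradedModule F m ℳ := by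
  classical
  refine ⟨⟨?_, ?_⟩, hsmul⟩
  · have key : ∀ (y : DirectSum ℤ fun i => ℳ i) (j : ℤ),
        π j (DirectSum.coeAddMonoidHom ℳ y) = (y j : M) := by
      intro y j
      induction y using DirectSum.induction_on with
      | zero => simp
      | of i x =>
        rw [DirectSum.coeAddMonoidHom_of, DirectSum.coe_of_apply]
        split_ifs with hij
        · subst hij; exact hself _ _ x.2
        · exact hzero _ _ hij _ x.2
      | add x y hx hy => rw [map_add, map_add, hx, hy, DirectSum.add_apply, AddSubgroup.coe_add]
    intro y z hyz
    refine DFinsupp.ext fun j => Subtype.ext ?_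
    rw [← key y j, hyz, key z j]
  · intro x
    refine hgen (DirectSum.coeAddMonoidHom ℳ).range x fun j => ?_
    exact ⟨DirectSum.of (fun i => ℳ i) j ⟨π j x, hmem j x⟩, DirectSum.coeAddMonoidHom_of _ _ _⟩

/-! ### Homogeneous submodules -/

/-- A submodule is homogeneous if it contains the homogeneous components of its elements. -/
def IsHomogeneous (h : IsGradedModule F m ℳ) (N : Submodule (MvPolynomial (Fin m) F) M) : Prop :=
  ∀ x ∈ N, ∀ j, h.proj j x ∈ N

variable {N : Submodule (MvPolynomial (Fin m) F) M}

theorem isHomogeneous_span_singleton (h : IsGradedModule F m ℳ) {j : ℤ} {x : M} (hx : x ∈ ℳ j) :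
    h.IsHomogeneous (Submodule.span (MvPolynomial (Fin m) F) {x}) := by
  intro z hz i
  obtain ⟨p, rfl⟩ := Submodule.mem_span_singleton.1 hz
  rw [h.proj_smul_eq_sum]
  refine Submodule.sum_mem _ fun a _ => Submodule.smul_mem _ _ ?_
  rw [h.proj_of_mem _ hx]
  split_ifs
  exacts [Submodule.mem_span_singleton_self x, Submodule.zero_mem _]

theorem IsHomogeneous.sup {h : IsGradedModule F m ℳ}
    {N' : Submodule (MvPolynomial (Fin m) F) M} (hN : h.IsHomogeneous N)
    (hN' : h.IsHomogeneous N') : h.IsHomogeneous (N ⊔ N') := by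
  intro x hx j
  obtain ⟨y, hy, z, hz, rfl⟩ := Submodule.mem_sup.1 hx
  rw [map_add]
  exact Submodule.add_mem_sup (hN y hy j) (hN' z hz j)

theorem quot_smul_mem (h : IsGradedModule F m ℳ) (N : Submodule (MvPolynomial (Fin m) F) M)
    (a : ℕ) (b : ℤ) (p : MvPolynomial (Fin m) F) (x : M ⧸ N) (hp : p.IsHomogeneous a)
    (hx : x ∈ quotGrading ℳ N b) : p • x ∈ quotGrading ℳ N (a + b) := by
  obtain ⟨y, hy, rfl⟩ := hx
  exact ⟨p • y, h.smul_mem a b p y hp hy, map_smul N.mkQ p y⟩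

/-- The quotient by a homogeneous submodule is graded. -/
theorem quot (h : IsGradedModule F m ℳ) (hN : h.IsHomogeneous N) :
    IsGradedModule F m (quotGrading ℳ N) := by
  let π : ℤ → (M ⧸ N) →+ (M ⧸ N) := fun j =>
    QuotientAddGroup.map N.toAddSubgroup N.toAddSubgroup (h.proj j) fun x hx => hN x hx j
  have hπ : ∀ j x, π j (N.mkQ x) = N.mkQ (h.proj j x) := fun j x => rfl
  refine of_proj π ?_ ?_ ?_ ?_ (h.quot_smul_mem N)
  · intro j x
    obtain ⟨y, rfl⟩ := N.mkQ_surjective x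
    exact ⟨_, h.proj_mem j y, (hπ j y).symm⟩
  · rintro j _ ⟨y, hy, rfl⟩
    exact (hπ j y).trans (by rw [h.proj_eq_self hy]; rfl)
  · rintro i j hij _ ⟨y, hy, rfl⟩
    exact (hπ j y).trans (by rw [h.proj_eq_zero hy hij, map_zero])
  · intro L x hx
    obtain ⟨y, rfl⟩ := N.mkQ_surjective x
    exact h.mem_of_proj_mem (L.comap N.mkQ.toAddMonoidHom) fun j => hx j

/-- The nonzero homogeneous elements of `N` have degree at most `D`. -/
def DegreeLE (ℳ : ℤ → AddSubgroup M) (N : Submodule (MvPolynomial (Fin m) F) M) (D : ℤ) : Prop :=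
  ∀ j, D < j → ∀ x ∈ N, x ∈ ℳ j → x = 0

/-- A finitely generated graded module has a largest homogeneous submodule `K` living in bounded
degrees (its local cohomology `H⁰` at the irrelevant ideal). By maximality, `M ⧸ K` has no nonzero
homogeneous element annihilated by all variables. -/
theorem exists_degreeLE_maximal [Module.Finite (MvPolynomial (Fin m) F) M]
    (h : IsGradedModule F m ℳ) :
    ∃ (K : Submodule (MvPolynomial (Fin m) F) M) (D : ℤ), h.IsHomogeneous K ∧ DegreeLE ℳ K D ∧
      ∀ (j : ℤ) (x : M), x ∈ ℳ j →
        (∀ k, (X k : MvPolynomial (Fin m) F) • x ∈ K) → x ∈ K := by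
  obtain ⟨K, ⟨hK, D, hD⟩, hmax⟩ := (wellFounded_gt :
    WellFounded fun A B : Submodule (MvPolynomial (Fin m) F) M => A > B).has_min
      {K | h.IsHomogeneous K ∧ ∃ D, DegreeLE ℳ K D}
      ⟨⊥, fun x hx j => by rw [(Submodule.mem_bot _).1 hx, map_zero]; exact Submodule.zero_mem _,
        0, fun j _ x hx _ => (Submodule.mem_bot _).1 hx⟩
  refine ⟨K, D, hK, hD, fun j x hx hX => ?_⟩
  have hpos : ∀ (a : ℕ) (p : MvPolynomial (Fin m) F), p.IsHomogeneous (a + 1) → p • x ∈ K := by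
    intro a p hp
    refine AddSubgroup.closure_induction (p := fun q _ => q • x ∈ K) ?_ ?_ ?_ ?_
      hp.mem_closure_X_mul
    · rintro _ ⟨k, r, -, rfl⟩
      rw [mul_comm, mul_smul]
      exact K.smul_mem r (hX k)
    · rw [zero_smul]; exact K.zero_mem
    · intro p q _ _ hp hq
      rw [add_smul]; exact K.add_mem hp hq
    · intro p _ hp
      rw [neg_smul]; exact K.neg_mem hp
  -- otherwise `K + (x) = K + F x` would be a larger homogeneous submodule in bounded degrees
  by_contra hxK
  refine hmax (K ⊔ Submodule.span _ {x}) ⟨hK.sup (h.isHomogeneous_span_singleton hx),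
    max D j, ?_⟩ ?_
  · intro i hi z hz hzi
    refine hD i ((le_max_left _ _).trans_lt hi) z ?_ hzi
    obtain ⟨y, hy, w, hw, rfl⟩ := Submodule.mem_sup.1 hz
    obtain ⟨p, rfl⟩ := Submodule.mem_span_singleton.1 hw
    rw [← h.proj_eq_self hzi, map_add, h.proj_smul_eq_sum]
    refine K.add_mem (hK y hy i) (K.sum_mem fun a _ => ?_)
    rw [h.proj_of_mem _ hx]
    split_ifs with ha
    · obtain ⟨b, rfl⟩ : ∃ b, a = b + 1 := ⟨a - 1, by
        have := (le_max_right D j).trans_lt hi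
        omega⟩
      exact hpos b _ (homogeneousComponent_isHomogeneous _ p)
    · rw [smul_zero]; exact K.zero_mem
  · exact lt_of_le_of_ne le_sup_left fun heq => hxK <| by
      rw [heq]; exact Submodule.mem_sup_right (Submodule.mem_span_singleton_self x)

/-! ### Finite length and degrees -/

/-- A graded module of finite length vanishes in large degrees. -/
theorem eq_bot_of_isFiniteLength (h : IsGradedModule F m ℳ)
    (hfin : IsFiniteLength (MvPolynomial (Fin m) F) M) :
    ∃ J : ℕ, ∀ j : ℕ, J ≤ j → ℳ j = ⊥ := by
  have : IsArtinian (MvPolynomial (Fin m) F) M :=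
    (isFiniteLength_iff_isNoetherian_isArtinian.1 hfin).2
  -- the descending chain of the submodules of elements without components below degree `j`
  let T : ℕ → Submodule (MvPolynomial (Fin m) F) M := fun j =>
    { carrier := {x | ∀ i : ℤ, i < j → h.proj i x = 0}
      zero_mem' := fun i _ => map_zero _
      add_mem' := fun {x y} hx hy i hi => by rw [map_add, hx i hi, hy i hi, add_zero]
      smul_mem' := fun p x hx i hi => by
        rw [h.proj_smul_eq_sum]
        exact Finset.sum_eq_zero fun a _ => by rw [hx _ (by omega), smul_zero] }
  have hT : Antitone T := fun i j hij x hx k hk => hx k (by omega)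
  obtain ⟨J, hJ⟩ := IsArtinian.monotone_stabilizes
    (⟨fun j => OrderDual.toDual (T j), fun i j hij => hT hij⟩ :
      ℕ →o (Submodule (MvPolynomial (Fin m) F) M)ᵒᵈ)
  refine ⟨J, fun j hj => (AddSubgroup.eq_bot_iff_forall _).2 fun x hx => ?_⟩
  have hxj : x ∈ T j := fun i hi => h.proj_eq_zero hx (by omega)
  have hxj' : x ∈ T (j + 1) := by
    have h1 : T J = T j := hJ j hj
    have h2 : T J = T (j + 1) := hJ (j + 1) (by omega)
    rwa [← h2, h1]
  rw [← h.proj_eq_self hx]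
  exact hxj' j (by push_cast; omega)

/-- A graded module generated in degree `0` vanishes in negative degrees. -/
theorem proj_eq_zero_of_neg (h : IsGradedModule F m ℳ)
    (hgen : Submodule.span (MvPolynomial (Fin m) F) (ℳ 0 : Set M) = ⊤) {j : ℤ} (hj : j < 0)
    (x : M) : h.proj j x = 0 := by
  have hx : x ∈ Submodule.span (MvPolynomial (Fin m) F) (ℳ 0 : Set M) := hgen ▸ Submodule.mem_top
  induction hx using Submodule.closure_induction with
  | zero => exact map_zero _
  | add x y _ _ hx hy => rw [map_add, hx, hy, add_zero]
  | smul_mem p y hy =>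
    rw [h.proj_smul_eq_sum]
    refine Finset.sum_eq_zero fun a _ => ?_
    rw [h.proj_eq_zero hy (by omega), smul_zero]

/-- In a graded module generated in degree `0`, a submodule containing one nonnegative degree
contains the next one. -/
theorem le_of_le_succ (h : IsGradedModule F m ℳ)
    (hgen : Submodule.span (MvPolynomial (Fin m) F) (ℳ 0 : Set M) = ⊤) {b : ℕ}
    (hN : ∀ x ∈ ℳ b, x ∈ N) : ∀ x ∈ ℳ ((b + 1 : ℕ) : ℤ), x ∈ N := by
  intro x hx
  rw [← h.proj_eq_self hx]
  clear hx
  have hx : x ∈ Submodule.span (MvPolynomial (Fin m) F) (ℳ 0 : Set M) := hgen ▸ Submodule.mem_top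
  induction hx using Submodule.closure_induction with
  | zero => rw [map_zero]; exact N.zero_mem
  | add x y _ _ hx hy => rw [map_add]; exact N.add_mem hx hy
  | smul_mem p y hy =>
    rw [h.proj_smul_eq_sum]
    refine N.sum_mem fun a _ => ?_
    rw [h.proj_of_mem _ hy]
    split_ifs with ha
    · obtain rfl : a = b + 1 := by omega
      refine AddSubgroup.closure_induction (p := fun q _ => q • y ∈ N) ?_ ?_ ?_ ?_
        (homogeneousComponent_isHomogeneous (b + 1) p).mem_closure_X_mul
      · rintro _ ⟨k, r, hr, rfl⟩
        rw [mul_smul]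
        refine N.smul_mem _ (hN _ ?_)
        simpa using h.smul_mem b 0 r y hr hy
      · rw [zero_smul]; exact N.zero_mem
      · intro p q _ _ hp hq
        rw [add_smul]; exact N.add_mem hp hq
      · intro p _ hp
        rw [neg_smul]; exact N.neg_mem hp
    · rw [smul_zero]; exact N.zero_mem

theorem le_of_le (h : IsGradedModule F m ℳ)
    (hgen : Submodule.span (MvPolynomial (Fin m) F) (ℳ 0 : Set M) = ⊤) {b c : ℕ} (hbc : b ≤ c)
    (hN : ∀ x ∈ ℳ b, x ∈ N) : ∀ x ∈ ℳ c, x ∈ N := by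
  induction c, hbc using Nat.le_induction with
  | base => exact hN
  | succ c _ ih => exact h.le_of_le_succ hgen ih

/-- A finitely generated graded module, generated in degree `0`, that vanishes in some nonnegative
degree has finite length: it is finite-dimensional over the ground field. -/
theorem isFiniteLength_of_eq_bot [Module.Finite (MvPolynomial (Fin m) F) M]
    (h : IsGradedModule F m ℳ)
    (hgen : Submodule.span (MvPolynomial (Fin m) F) (ℳ 0 : Set M) = ⊤) {b : ℕ}
    (hb : ℳ b = ⊥) : IsFiniteLength (MvPolynomial (Fin m) F) M := by
  have hzero : ∀ c : ℕ, b ≤ c → ∀ x ∈ ℳ c, x = 0 := fun c hc x hx =>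
    (Submodule.mem_bot (MvPolynomial (Fin m) F)).1 <| h.le_of_le hgen hc
      (fun x hx => (Submodule.mem_bot _).2 ((AddSubgroup.eq_bot_iff_forall _).1 hb x hx)) x hx
  have hkill : ∀ (a : ℕ) (p : MvPolynomial (Fin m) F), p.IsHomogeneous a → b ≤ a →
      ∀ x : M, p • x = 0 := by
    intro a p hp ha x
    refine h.eq_zero_of_proj_eq_zero fun j => ?_
    by_cases hj : j < a
    · rw [h.proj_smul hp, h.proj_eq_zero_of_neg hgen (by omega), smul_zero]
    · lift j to ℕ using by omega
      exact hzero j (by omega) _ (h.proj_mem _ _)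
  let _ : Module F M := Module.compHom M (C : F →+* MvPolynomial (Fin m) F)
  have hCsmul : ∀ (a : F) (x : M), a • x = (C a : MvPolynomial (Fin m) F) • x := fun _ _ => rfl
  have : IsScalarTower F (MvPolynomial (Fin m) F) M :=
    ⟨fun a p x => by rw [MvPolynomial.smul_eq_C_mul, mul_smul, hCsmul]⟩
  obtain ⟨s, hs⟩ := Module.Finite.fg_top (R := MvPolynomial (Fin m) F) (M := M)
  have hU : Set.Finite {u : Fin m →₀ ℕ | u.degree ≤ b} := Finsupp.finite_of_degree_le b
  -- monomials of degree at most `b` times the generators span `M` over `F`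
  have hfin : Module.Finite F M := by
    refine ⟨Submodule.fg_def.2 ⟨(fun q : (Fin m →₀ ℕ) × M =>
      (monomial q.1 (1 : F)) • q.2) '' ({u | u.degree ≤ b} ×ˢ (s : Set M)),
      (hU.prod s.finite_toSet).image _, ?_⟩⟩
    refine eq_top_iff.2 fun x _ => ?_
    have hx : x ∈ Submodule.span (MvPolynomial (Fin m) F) (s : Set M) :=
      hs ▸ Submodule.mem_top
    induction hx using Submodule.closure_induction with
    | zero => exact Submodule.zero_mem _
    | add x y _ _ hx hy => exact Submodule.add_mem _ (hx trivial) (hy trivial)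
    | smul_mem p y hy =>
      rw [p.as_sum, Finset.sum_smul]
      refine Submodule.sum_mem _ fun u _ => ?_
      by_cases hu : u.degree ≤ b
      · have : monomial u (coeff u p) • y = coeff u p • (monomial u (1 : F) • y) := by
          rw [hCsmul, smul_smul, C_mul_monomial, mul_one]
        rw [this]
        exact Submodule.smul_mem _ _ (Submodule.subset_span ⟨(u, y), ⟨hu, hy⟩, rfl⟩)
      · rw [hkill u.degree _ (isHomogeneous_monomial _ rfl) (by omega)]
        exact Submodule.zero_mem _
  have : IsArtinian (MvPolynomial (Fin m) F) M := isArtinian_of_tower F inferInstance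
  exact isFiniteLength_iff_isNoetherian_isArtinian.2 ⟨inferInstance, inferInstance⟩

end IsGradedModule

end Grading

/-! ### Koszul homology -/

section Koszul

variable {F : Type*} [Field F] {m : ℕ} {M : Type*} [AddCommGroup M]
  [Module (MvPolynomial (Fin m) F) M] {ℳ : ℤ → AddSubgroup M}

theorem mem_koszulChains {i : ℕ} {j : ℤ} {c : Finset (Fin m) → M} :
    c ∈ koszulChains m ℳ i j ↔
      ∀ A : Finset (Fin m), (A.card = i → c A ∈ ℳ (j - i)) ∧ (A.card ≠ i → c A = 0) := by
  simp only [koszulChains, AddSubgroup.mem_pi, Set.mem_univ, true_imp_iff]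
  refine forall_congr' fun A => ?_
  split_ifs with hA <;> simp [hA]

variable (F m ℳ) in
/-- The part of degree `j` of `Tor_i(M, F)` is zero: homogeneous Koszul cycles of this bidegree are
boundaries of homogeneous chains. -/
def TorVanishes (i : ℕ) (j : ℤ) : Prop :=
  ∀ c ∈ koszulChains m ℳ i j, koszulDiff F m M c = 0 →
    ∃ b ∈ koszulChains m ℳ (i + 1) j, koszulDiff F m M b = c

theorem nontrivial_gradedTor_iff {i : ℕ} {j : ℤ} :
    Nontrivial (GradedTor F m ℳ i j) ↔ ¬ TorVanishes F m ℳ i j := by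
  rw [← not_subsingleton_iff_nontrivial, not_iff_not, GradedTor,
    QuotientAddGroup.subsingleton_iff, AddSubgroup.addSubgroupOf_eq_top]
  exact ⟨fun h c hc hc' => h ⟨hc, hc'⟩, fun h c hc => h c hc.1 hc.2⟩

variable (F m ℳ) in
/-- The Castelnuovo-Mumford regularity is at most `r`. -/
def RegularityLE (r : ℤ) : Prop :=
  ∀ (i : ℕ) (j : ℤ), r < j - i → TorVanishes F m ℳ i j

theorem RegularityLE.mono {r r' : ℤ} (h : RegularityLE F m ℳ r) (hr : r ≤ r') :
    RegularityLE F m ℳ r' :=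
  fun i j hij => h i j (hr.trans_lt hij)

/-- The supremum defining the regularity is attained at the least integer bound. -/
theorem regularity_eq_intCast {r : ℤ} (h : ∀ s, RegularityLE F m ℳ s ↔ r ≤ s) :
    regularity F m ℳ = (((r : ℤ) : ℝ) : EReal) := by
  have hle : ∀ s : ℤ, RegularityLE F m ℳ s → regularity F m ℳ ≤ (((s : ℤ) : ℝ) : EReal) := by
    intro s hs
    refine iSup_le fun i => iSup_le fun j => iSup_le fun hij => ?_
    have : j - i ≤ s := by
      by_contra! hlt
      exact nontrivial_gradedTor_iff.1 hij (hs i j hlt)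
    exact_mod_cast this
  refine le_antisymm (hle r ((h r).2 le_rfl)) ?_
  have : ¬ RegularityLE F m ℳ (r - 1) := fun hr => by
    have := (h _).1 hr
    omega
  simp only [RegularityLE, not_forall] at this
  obtain ⟨i, j, hij, hT⟩ := this
  refine le_trans ?_ (le_iSup_of_le i (le_iSup_of_le j
    (le_iSup_of_le (nontrivial_gradedTor_iff.2 hT) le_rfl)))
  have : r ≤ j - i := by omega
  exact_mod_cast this

theorem neg_one_pow_mul_smul_mem {ℳ : ℤ → AddSubgroup M} {j : ℤ} {a : ℕ} {k : Fin m} {x : M}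
    (hx : (X k : MvPolynomial (Fin m) F) • x ∈ ℳ j) :
    ((-1) ^ a * X k : MvPolynomial (Fin m) F) • x ∈ ℳ j := by
  rcases neg_one_pow_eq_or (MvPolynomial (Fin m) F) a with h | h <;> rw [h]
  · rwa [one_mul]
  · rw [neg_one_mul, neg_smul]
    exact neg_mem hx

theorem neg_one_pow_mul_smul_eq_zero {a : ℕ} {k : Fin m} {x : M} :
    ((-1) ^ a * X k : MvPolynomial (Fin m) F) • x = 0 ↔
      (X k : MvPolynomial (Fin m) F) • x = 0 := by
  rcases neg_one_pow_eq_or (MvPolynomial (Fin m) F) a with h | h <;> rw [h] <;> simp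

theorem koszulDiff_mem (hX : ∀ (k : Fin m) (j : ℤ) (x : M), x ∈ ℳ j →
      (X k : MvPolynomial (Fin m) F) • x ∈ ℳ (j + 1)) {i : ℕ} {j : ℤ} {c : Finset (Fin m) → M}
    (hc : c ∈ koszulChains m ℳ (i + 1) j) : koszulDiff F m M c ∈ koszulChains m ℳ i j := by
  rw [mem_koszulChains] at hc ⊢
  intro A
  rw [koszulDiff_apply]
  constructor
  · intro hA
    refine sum_mem fun k hk => neg_one_pow_mul_smul_mem ?_
    have := hX k _ _ ((hc (insert k A)).1 (by
      rw [Finset.card_insert_of_notMem (Finset.mem_compl.1 hk), hA]))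
    convert this using 2
    push_cast; ring
  · intro hA
    refine Finset.sum_eq_zero fun k hk => ?_
    rw [(hc (insert k A)).2, smul_zero]
    rw [Finset.card_insert_of_notMem (Finset.mem_compl.1 hk)]
    omega

theorem koszulDiff_eq_zero_of_mem_zero {j : ℤ} {c : Finset (Fin m) → M}
    (hc : c ∈ koszulChains m ℳ 0 j) : koszulDiff F m M c = 0 := by
  funext A
  rw [koszulDiff_apply]
  refine Finset.sum_eq_zero fun k _ => ?_
  rw [(mem_koszulChains.1 hc (insert k A)).2 (by simp), smul_zero]

/-! ### Regularity and socles -/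

/-- The part of degree `j` of `Tor_i(M, F)` is a subquotient of a power of `M_{j-i}`. In particular
the regularity is at most the top degree. -/
theorem torVanishes_of_eq_bot {i : ℕ} {j : ℤ} (h : ℳ (j - i) = ⊥) : TorVanishes F m ℳ i j := by
  intro c hc _
  refine ⟨0, zero_mem _, ?_⟩
  rw [map_zero]
  funext A
  by_cases hA : A.card = i
  · have := (mem_koszulChains.1 hc A).1 hA
    rw [h] at this
    exact ((AddSubgroup.mem_bot).1 this).symm
  · exact ((mem_koszulChains.1 hc A).2 hA).symm

/-- A socle element `x` of degree `r` gives the nonzero class `x ⊗ e_0 ∧ ⋯ ∧ e_{m-1}`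
of the last Koszul homology. -/
theorem not_torVanishes_of_socle {r : ℤ} {x : M} (hx : x ∈ ℳ r) (hx0 : x ≠ 0)
    (hX : ∀ k : Fin m, (X k : MvPolynomial (Fin m) F) • x = 0) :
    ¬ TorVanishes F m ℳ m (r + m) := by
  intro h
  have hmem : Pi.single Finset.univ x ∈ koszulChains m ℳ m (r + m) := by
    rw [mem_koszulChains]
    intro A
    constructor
    · intro hA
      obtain rfl : A = Finset.univ := Finset.card_eq_iff_eq_univ A |>.1 (by simpa using hA)
      simpa using hx
    · intro hA
      refine Pi.single_eq_of_ne ?_ _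
      rintro rfl
      simp at hA
  have hcycle : koszulDiff F m M (Pi.single Finset.univ x) = 0 := by
    funext A
    rw [koszulDiff_apply]
    refine Finset.sum_eq_zero fun k _ => ?_
    rw [neg_one_pow_mul_smul_eq_zero]
    by_cases hA : insert k A = Finset.univ
    · rw [hA, Pi.single_eq_same, hX]
    · rw [Pi.single_eq_of_ne hA, smul_zero]
  obtain ⟨b, hb, hbc⟩ := h _ hmem hcycle
  have hb0 : b = 0 := by
    funext A
    refine (mem_koszulChains.1 hb A).2 ?_
    have := A.card_le_univ
    rw [Fintype.card_fin] at this
    omega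
  rw [hb0, map_zero] at hbc
  exact hx0 (by simpa using (congrFun hbc Finset.univ).symm)

/-- The last Koszul homology is the socle. -/
theorem torVanishes_of_socle_eq_zero {r : ℤ}
    (h : ∀ x ∈ ℳ r, (∀ k : Fin m, (X k : MvPolynomial (Fin m) F) • x = 0) → x = 0) :
    TorVanishes F m ℳ m (r + m) := by
  intro c hc hdc
  refine ⟨0, zero_mem _, ?_⟩
  rw [map_zero]
  funext A
  by_cases hA : A.card = m
  · obtain rfl : A = Finset.univ := Finset.card_eq_iff_eq_univ A |>.1 (by simpa using hA)
    refine (h _ ?_ fun k => ?_).symm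
    · simpa using (mem_koszulChains.1 hc Finset.univ).1 hA
    · have := congrFun hdc (Finset.univ.erase k)
      rw [koszulDiff_apply, Finset.sum_eq_single k] at this
      · rwa [Pi.zero_apply, neg_one_pow_mul_smul_eq_zero,
          Finset.insert_erase (Finset.mem_univ k)] at this
      · intro l hl hlk
        simp at hl
        exact absurd hl hlk
      · intro hk
        simp at hk
  · exact ((mem_koszulChains.1 hc A).2 hA).symm

/-! ### The long exact sequence -/

section LongExact

variable {A B C : Type*} [AddCommGroup A] [AddCommGroup B] [AddCommGroup C]
  [Module (MvPolynomial (Fin m) F) A] [Module (MvPolynomial (Fin m) F) B]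
  [Module (MvPolynomial (Fin m) F) C]

/-- `0 → A → B → C → 0` is a short exact sequence of graded modules, and multiplication by the
variables has degree `1` on `B` (hence on `A` and `C`). -/
structure GradedShortExact (𝒜 : ℤ → AddSubgroup A) (ℬ : ℤ → AddSubgroup B)
    (𝒞 : ℤ → AddSubgroup C) (f : A →ₗ[MvPolynomial (Fin m) F] B)
    (g : B →ₗ[MvPolynomial (Fin m) F] C) : Prop where
  injective : Function.Injective f
  mem_iff : ∀ j a, f a ∈ ℬ j ↔ a ∈ 𝒜 j
  exact : ∀ b, g b = 0 ↔ ∃ a, f a = b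
  map_mem : ∀ j, ∀ b ∈ ℬ j, g b ∈ 𝒞 j
  exists_lift : ∀ j, ∀ c ∈ 𝒞 j, ∃ b ∈ ℬ j, g b = c
  X_smul_mem : ∀ (k : Fin m) (j : ℤ) (b : B), b ∈ ℬ j →
    (X k : MvPolynomial (Fin m) F) • b ∈ ℬ (j + 1)

theorem koszulDiff_comp (f : A →ₗ[MvPolynomial (Fin m) F] B) (c : Finset (Fin m) → A) :
    koszulDiff F m B (f ∘ c) = f ∘ koszulDiff F m A c := by
  funext S
  simp [koszulDiff_apply]

namespace GradedShortExact

variable {𝒜 : ℤ → AddSubgroup A} {ℬ : ℤ → AddSubgroup B} {𝒞 : ℤ → AddSubgroup C}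
  {f : A →ₗ[MvPolynomial (Fin m) F] B} {g : B →ₗ[MvPolynomial (Fin m) F] C}

theorem comp_mem_chains (h : GradedShortExact 𝒜 ℬ 𝒞 f g) {i : ℕ} {j : ℤ}
    {b : Finset (Fin m) → B} (hb : b ∈ koszulChains m ℬ i j) :
    g ∘ b ∈ koszulChains m 𝒞 i j := by
  rw [mem_koszulChains] at hb ⊢
  exact fun S => ⟨fun hS => h.map_mem _ _ ((hb S).1 hS), fun hS => by simp [(hb S).2 hS]⟩

theorem comp_mem_chains_iff (h : GradedShortExact 𝒜 ℬ 𝒞 f g) {i : ℕ} {j : ℤ}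
    {a : Finset (Fin m) → A} : f ∘ a ∈ koszulChains m ℬ i j ↔ a ∈ koszulChains m 𝒜 i j := by
  simp only [mem_koszulChains, Function.comp_apply, h.mem_iff, map_eq_zero_iff f h.injective]

theorem exists_lift_chains (h : GradedShortExact 𝒜 ℬ 𝒞 f g) {i : ℕ} {j : ℤ}
    {c : Finset (Fin m) → C} (hc : c ∈ koszulChains m 𝒞 i j) :
    ∃ b ∈ koszulChains m ℬ i j, g ∘ b = c := by
  have : ∀ S, ∃ b, ((S.card = i → b ∈ ℬ (j - i)) ∧ (S.card ≠ i → b = 0)) ∧ g b = c S := by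
    intro S
    have hcS := mem_koszulChains.1 hc S
    by_cases hS : S.card = i
    · obtain ⟨b, hb, hbc⟩ := h.exists_lift _ _ (hcS.1 hS)
      exact ⟨b, ⟨fun _ => hb, fun h => absurd hS h⟩, hbc⟩
    · exact ⟨0, ⟨fun h => absurd h hS, fun _ => rfl⟩, by rw [hcS.2 hS, map_zero]⟩
  choose b hb hbc using this
  exact ⟨b, mem_koszulChains.2 hb, funext hbc⟩

theorem exists_of_comp_eq_zero (h : GradedShortExact 𝒜 ℬ 𝒞 f g) {i : ℕ} {j : ℤ}
    {b : Finset (Fin m) → B} (hb : b ∈ koszulChains m ℬ i j) (hgb : g ∘ b = 0) :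
    ∃ a ∈ koszulChains m 𝒜 i j, f ∘ a = b := by
  choose a ha using fun S => (h.exact (b S)).1 (congrFun hgb S)
  obtain rfl : f ∘ a = b := funext ha
  exact ⟨a, h.comp_mem_chains_iff.1 hb, rfl⟩

theorem comp_comp_eq_zero (h : GradedShortExact 𝒜 ℬ 𝒞 f g) (a : Finset (Fin m) → A) :
    g ∘ (f ∘ a) = 0 :=
  funext fun _ => (h.exact _).2 ⟨_, rfl⟩

theorem koszulDiff_eq_zero_of_comp (h : GradedShortExact 𝒜 ℬ 𝒞 f g) {a : Finset (Fin m) → A}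
    (ha : koszulDiff F m B (f ∘ a) = 0) : koszulDiff F m A a = 0 := by
  rw [koszulDiff_comp] at ha
  exact funext fun S => h.injective (by simpa using congrFun ha S)

theorem map_comp_sub (g : B →ₗ[MvPolynomial (Fin m) F] C) (b b' : Finset (Fin m) → B) :
    g ∘ (b - b') = g ∘ b - g ∘ b' :=
  funext fun _ => map_sub g _ _

theorem torVanishes_middle (h : GradedShortExact 𝒜 ℬ 𝒞 f g) {i : ℕ} {j : ℤ}
    (hA : TorVanishes F m 𝒜 i j) (hC : TorVanishes F m 𝒞 i j) : TorVanishes F m ℬ i j := by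
  intro b hb hdb
  obtain ⟨c', hc', hdc'⟩ := hC (g ∘ b) (h.comp_mem_chains hb) (by
    rw [koszulDiff_comp, hdb]; exact funext fun _ => map_zero g)
  obtain ⟨b', hb', rfl⟩ := h.exists_lift_chains hc'
  obtain ⟨a, ha, hab⟩ := h.exists_of_comp_eq_zero
    (sub_mem hb (koszulDiff_mem h.X_smul_mem hb'))
    (by rw [map_comp_sub, ← koszulDiff_comp, hdc', sub_self])
  obtain ⟨a', ha', rfl⟩ := hA a ha (h.koszulDiff_eq_zero_of_comp (by
    rw [hab, map_sub, hdb, koszulDiff_koszulDiff, sub_zero]))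
  refine ⟨b' + f ∘ a', add_mem hb' (h.comp_mem_chains_iff.2 ha'), ?_⟩
  rw [map_add, koszulDiff_comp f, hab, add_sub_cancel]

theorem torVanishes_left (h : GradedShortExact 𝒜 ℬ 𝒞 f g) {i : ℕ} {j : ℤ}
    (hB : TorVanishes F m ℬ i j) (hC : TorVanishes F m 𝒞 (i + 1) j) : TorVanishes F m 𝒜 i j := by
  intro a ha hda
  obtain ⟨b, hb, hdb⟩ := hB (f ∘ a) (h.comp_mem_chains_iff.2 ha) (by
    rw [koszulDiff_comp, hda]; exact funext fun _ => map_zero f)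
  obtain ⟨c', hc', hdc'⟩ := hC (g ∘ b) (h.comp_mem_chains hb) (by
    rw [koszulDiff_comp, hdb, h.comp_comp_eq_zero])
  obtain ⟨b', hb', rfl⟩ := h.exists_lift_chains hc'
  obtain ⟨a', ha', hab⟩ := h.exists_of_comp_eq_zero
    (sub_mem hb (koszulDiff_mem h.X_smul_mem hb'))
    (by rw [map_comp_sub, ← koszulDiff_comp, hdc', sub_self])
  refine ⟨a', ha', h.injective.comp_left ?_⟩
  change f ∘ koszulDiff F m A a' = f ∘ a
  rw [← koszulDiff_comp, hab, map_sub, hdb, koszulDiff_koszulDiff, sub_zero]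

theorem torVanishes_right (h : GradedShortExact 𝒜 ℬ 𝒞 f g) {i : ℕ} {j : ℤ}
    (hB : TorVanishes F m ℬ (i + 1) j) (hA : TorVanishes F m 𝒜 i j) :
    TorVanishes F m 𝒞 (i + 1) j := by
  intro c hc hdc
  obtain ⟨b, hb, rfl⟩ := h.exists_lift_chains hc
  obtain ⟨a, ha, hab⟩ := h.exists_of_comp_eq_zero (koszulDiff_mem h.X_smul_mem hb)
    (by rw [← koszulDiff_comp, hdc])
  obtain ⟨a', ha', rfl⟩ := hA a ha (h.koszulDiff_eq_zero_of_comp (by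
    rw [hab, koszulDiff_koszulDiff]))
  obtain ⟨b', hb', hdb'⟩ := hB (b - f ∘ a') (sub_mem hb (h.comp_mem_chains_iff.2 ha')) (by
    rw [map_sub, koszulDiff_comp, hab, sub_self])
  refine ⟨g ∘ b', h.comp_mem_chains hb', ?_⟩
  rw [koszulDiff_comp, hdb', map_comp_sub, h.comp_comp_eq_zero, sub_zero]

theorem torVanishes_right_zero (h : GradedShortExact 𝒜 ℬ 𝒞 f g) {j : ℤ}
    (hB : TorVanishes F m ℬ 0 j) : TorVanishes F m 𝒞 0 j := by
  intro c hc _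
  obtain ⟨b, hb, rfl⟩ := h.exists_lift_chains hc
  obtain ⟨b', hb', rfl⟩ := hB b hb (koszulDiff_eq_zero_of_mem_zero hb)
  exact ⟨g ∘ b', h.comp_mem_chains hb', koszulDiff_comp g b'⟩

theorem regularityLE_middle (h : GradedShortExact 𝒜 ℬ 𝒞 f g) {r : ℤ}
    (hA : RegularityLE F m 𝒜 r) (hC : RegularityLE F m 𝒞 r) : RegularityLE F m ℬ r :=
  fun i j hij => h.torVanishes_middle (hA i j hij) (hC i j hij)

theorem regularityLE_left (h : GradedShortExact 𝒜 ℬ 𝒞 f g) {r : ℤ}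
    (hB : RegularityLE F m ℬ r) (hC : RegularityLE F m 𝒞 (r - 1)) : RegularityLE F m 𝒜 r :=
  fun i j hij => h.torVanishes_left (hB i j hij) (hC (i + 1) j (by push_cast; omega))

theorem regularityLE_right (h : GradedShortExact 𝒜 ℬ 𝒞 f g) {r : ℤ}
    (hB : RegularityLE F m ℬ r) (hA : RegularityLE F m 𝒜 (r + 1)) : RegularityLE F m 𝒞 r := by
  rintro (_ | i) j hij
  · exact h.torVanishes_right_zero (hB 0 j hij)
  · exact h.torVanishes_right (hB _ j hij) (hA i j (by push_cast at hij; omega))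

end GradedShortExact

/-- The sequence `0 → N → M → M ⧸ N → 0`. -/
theorem gradedShortExact_mkQ (h : IsGradedModule F m ℳ)
    (N : Submodule (MvPolynomial (Fin m) F) M) :
    GradedShortExact (subGrading ℳ N) ℳ (quotGrading ℳ N) N.subtype N.mkQ where
  injective := N.injective_subtype
  mem_iff _ _ := Iff.rfl
  exact b := by simp
  map_mem _ b hb := ⟨b, hb, rfl⟩
  exists_lift := by rintro j _ ⟨b, hb, rfl⟩; exact ⟨b, hb, rfl⟩
  X_smul_mem k _ _ hb := h.X_smul_mem k hb

/-- The sequence `0 → K ⊓ P → P → (P + K) ⧸ K → 0`. -/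
theorem gradedShortExact_restrict (h : IsGradedModule F m ℳ)
    {K P : Submodule (MvPolynomial (Fin m) F) M} {Q : Submodule (MvPolynomial (Fin m) F) (M ⧸ K)}
    (hK : h.IsHomogeneous K) (hP : h.IsHomogeneous P) (hQ : P.map K.mkQ = Q) :
    GradedShortExact (subGrading ℳ (K ⊓ P)) (subGrading ℳ P) (subGrading (quotGrading ℳ K) Q)
      (Submodule.inclusion inf_le_right)
      (K.mkQ.restrict fun _ hx => hQ ▸ Submodule.mem_map_of_mem hx) where
  injective := Submodule.inclusion_injective _
  mem_iff _ _ := Iff.rfl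
  exact := by
    rintro ⟨b, hb⟩
    rw [← Subtype.coe_inj]
    change K.mkQ b = 0 ↔ _
    rw [Submodule.mkQ_apply, Submodule.Quotient.mk_eq_zero]
    refine ⟨fun hbK => ⟨⟨b, hbK, hb⟩, rfl⟩, ?_⟩
    rintro ⟨⟨a, ha, _⟩, hab⟩
    obtain rfl : a = b := congrArg Subtype.val hab
    exact ha
  map_mem _ b hb := ⟨b.1, hb, rfl⟩
  exists_lift := by
    rintro j ⟨c, hc⟩ ⟨y, hy, rfl⟩
    subst hQ
    obtain ⟨x, hx, hxy⟩ := hc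
    refine ⟨⟨h.proj j x, hP x hx j⟩, h.proj_mem j x, Subtype.ext ?_⟩
    change K.mkQ (h.proj j x) = K.mkQ y
    have hxy' : x - y ∈ K := (Submodule.Quotient.eq K).1 hxy
    refine (Submodule.Quotient.eq K).2 ?_
    rw [← h.proj_eq_self hy, ← map_sub]
    exact hK _ hxy' j
  X_smul_mem k _ _ hb := h.X_smul_mem k hb

end LongExact

/-! ### Finiteness of the regularity -/

/-- Exterior multiplication by `e_k`, a contracting homotopy for multiplication by `x_k` on the
Koszul complex. -/
noncomputable def koszulWedge (k : Fin m) (c : Finset (Fin m) → M) (A : Finset (Fin m)) : M :=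
  if k ∈ A then ((-1) ^ (A.filter (· < k)).card : MvPolynomial (Fin m) F) • c (A.erase k) else 0

/-- On cycles, multiplication by a variable is the boundary of the exterior product. -/
theorem koszulDiff_koszulWedge (k : Fin m) {c : Finset (Fin m) → M}
    (hc : koszulDiff F m M c = 0) :
    koszulDiff F m M (koszulWedge (F := F) k c) = (X k : MvPolynomial (Fin m) F) • c := by
  have key : ∀ (S : Finset (Fin m)) (a b : Fin m), a ∉ S →
      ((insert a S).filter (· < b)).card = (S.filter (· < b)).card + if a < b then 1 else 0 := by
    intro S a b ha
    rw [Finset.filter_insert]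
    split_ifs
    · rw [Finset.card_insert_of_notMem (by simp [ha])]
    · rfl
  funext A
  rw [koszulDiff_apply, Pi.smul_apply]
  by_cases hk : k ∈ A
  · obtain ⟨S, hS, rfl⟩ : ∃ S, k ∉ S ∧ insert k S = A :=
      ⟨A.erase k, Finset.notMem_erase k A, Finset.insert_erase hk⟩
    have hcycle := congrFun hc S
    have hcompl : Sᶜ = insert k (insert k S)ᶜ := by
      ext l
      by_cases hl : l = k <;> simp [hl, hS]
    rw [koszulDiff_apply, hcompl, Finset.sum_insert (by simp), Pi.zero_apply] at hcycle
    have hsign : ((-1) ^ (S.filter (· < k)).card * (-1) ^ (S.filter (· < k)).card :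
        MvPolynomial (Fin m) F) = 1 := by
      rw [← mul_pow]; simp
    -- the cycle condition at `S` expresses `x_k c_A` through the other terms
    have hXk : (X k : MvPolynomial (Fin m) F) • c (insert k S)
        = -((-1) ^ (S.filter (· < k)).card : MvPolynomial (Fin m) F) •
          ∑ l ∈ (insert k S)ᶜ, ((-1) ^ (S.filter (· < l)).card * X l :
            MvPolynomial (Fin m) F) • c (insert l S) := by
      rw [← add_eq_zero_iff_neg_eq.1 hcycle, neg_smul, smul_neg, neg_neg, smul_smul, ← mul_assoc,
        hsign, one_mul]
    rw [hXk, Finset.smul_sum]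
    refine Finset.sum_congr rfl fun l hl => ?_
    simp only [Finset.mem_compl, Finset.mem_insert, not_or] at hl
    obtain ⟨hlk, hlS⟩ := hl
    have herase : (insert l (insert k S)).erase k = insert l S := by
      rw [Finset.insert_comm, Finset.erase_insert (by simp [hS, Ne.symm hlk])]
    rw [koszulWedge, if_pos (by simp), herase, smul_smul, smul_smul,
      key (insert k S) l k (by simp [hlk, hlS]), key S k k hS, key S k l hS]
    congr 1
    rcases lt_or_gt_of_ne hlk with hlt | hlt
    · simp only [hlt, hlt.not_gt, lt_irrefl, if_true, if_false]
      ring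
    · simp only [hlt, hlt.not_gt, lt_irrefl, if_true, if_false]
      ring
  · rw [Finset.sum_eq_single k]
    · rw [koszulWedge, if_pos (by simp), Finset.erase_insert hk, smul_smul, key A k k hk,
        if_neg (lt_irrefl k), add_zero, mul_right_comm, ← mul_pow]
      simp
    · intro l _ hlk
      rw [koszulWedge, if_neg (by simp [hk, Ne.symm hlk]), smul_zero]
    · intro h
      simp [hk] at h

/-- Forms of positive degree annihilate Koszul homology. -/
theorem smul_mem_range_koszulDiff {c : Finset (Fin m) → M} (hc : koszulDiff F m M c = 0) {a : ℕ}
    {p : MvPolynomial (Fin m) F} (hp : p.IsHomogeneous (a + 1)) :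
    p • c ∈ LinearMap.range (koszulDiff F m M) := by
  refine AddSubgroup.closure_induction
    (p := fun q _ => q • c ∈ LinearMap.range (koszulDiff F m M)) ?_ ?_ ?_ ?_ hp.mem_closure_X_mul
  · rintro _ ⟨k, r, -, rfl⟩
    rw [mul_comm, mul_smul]
    exact Submodule.smul_mem _ r ⟨_, koszulDiff_koszulWedge k hc⟩
  · rw [zero_smul]; exact Submodule.zero_mem _
  · intro p q _ _ hp hq
    rw [add_smul]; exact Submodule.add_mem _ hp hq
  · intro p _ hp
    rw [neg_smul]; exact Submodule.neg_mem _ hp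

namespace IsGradedModule

/-- The projection of the Koszul complex onto its chains of bidegree `(i, j)`. -/
noncomputable def koszulProj (h : IsGradedModule F m ℳ) (i : ℕ) (j : ℤ) :
    (Finset (Fin m) → M) →+ (Finset (Fin m) → M) where
  toFun c A := if A.card = i then h.proj (j - i) (c A) else 0
  map_zero' := by funext A; simp
  map_add' c c' := by funext A; by_cases hA : A.card = i <;> simp [hA]

theorem koszulProj_apply (h : IsGradedModule F m ℳ) (i : ℕ) (j : ℤ) (c : Finset (Fin m) → M)
    (A : Finset (Fin m)) :
    h.koszulProj i j c A = if A.card = i then h.proj (j - i) (c A) else 0 := rfl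

theorem koszulProj_mem (h : IsGradedModule F m ℳ) (i : ℕ) (j : ℤ) (c : Finset (Fin m) → M) :
    h.koszulProj i j c ∈ koszulChains m ℳ i j := by
  rw [mem_koszulChains]
  refine fun A => ⟨fun hA => ?_, fun hA => ?_⟩
  · rw [koszulProj_apply, if_pos hA]
    exact h.proj_mem _ _
  · rw [koszulProj_apply, if_neg hA]

theorem koszulProj_of_mem (h : IsGradedModule F m ℳ) {i' : ℕ} {j' : ℤ} (i : ℕ) (j : ℤ)
    {c : Finset (Fin m) → M} (hc : c ∈ koszulChains m ℳ i' j') :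
    h.koszulProj i j c = if i' = i ∧ j' = j then c else 0 := by
  rw [mem_koszulChains] at hc
  funext A
  rw [koszulProj_apply]
  by_cases hA' : A.card = i'
  · by_cases hi : i' = i
    · subst hi
      rw [if_pos hA', h.proj_of_mem _ ((hc A).1 hA')]
      by_cases hj : j' = j
      · simp [hj]
      · rw [if_neg (by omega), if_neg (by simp [hj]), Pi.zero_apply]
    · rw [if_neg (by omega), if_neg (by simp [hi]), Pi.zero_apply]
  · have h0 := (hc A).2 hA'
    rw [h0, map_zero]
    split_ifs <;> simp [h0]

theorem koszulDiff_koszulProj (h : IsGradedModule F m ℳ) (i : ℕ) (j : ℤ)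
    (c : Finset (Fin m) → M) :
    koszulDiff F m M (h.koszulProj (i + 1) j c) = h.koszulProj i j (koszulDiff F m M c) := by
  funext A
  rw [koszulProj_apply, koszulDiff_apply, koszulDiff_apply, map_sum]
  have hcard : ∀ k ∈ Aᶜ, (insert k A).card = A.card + 1 := fun k hk =>
    Finset.card_insert_of_notMem (Finset.mem_compl.1 hk)
  by_cases hA : A.card = i
  · rw [if_pos hA]
    refine Finset.sum_congr rfl fun k hk => ?_
    have hhom :
        ((-1) ^ (A.filter (· < k)).card * X k : MvPolynomial (Fin m) F).IsHomogeneous 1 := by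
      rcases neg_one_pow_eq_or (MvPolynomial (Fin m) F) (A.filter (· < k)).card with h | h <;>
        rw [h]
      · rw [one_mul]; exact isHomogeneous_X F k
      · rw [neg_one_mul]; exact (isHomogeneous_X F k).neg
    rw [koszulProj_apply, if_pos (by rw [hcard k hk, hA]), h.proj_smul hhom]
    congr 3
    push_cast; ring
  · rw [if_neg hA]
    refine Finset.sum_eq_zero fun k hk => ?_
    rw [koszulProj_apply, if_neg (by rw [hcard k hk]; omega), smul_zero]

/-- A finitely generated graded module has finite regularity: Koszul cycles are generated in
bounded degrees, and Koszul homology is annihilated by the variables. -/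
theorem exists_regularityLE [Module.Finite (MvPolynomial (Fin m) F) M]
    (h : IsGradedModule F m ℳ) : ∃ r, RegularityLE F m ℳ r := by
  -- the ascending chain of the submodules generated by the homogeneous cycles of degree at most `D`
  let T : ℕ → Submodule (MvPolynomial (Fin m) F) (Finset (Fin m) → M) := fun D =>
    Submodule.span _ {z | ∃ (i : ℕ) (j : ℤ), j ≤ D ∧ z ∈ koszulChains m ℳ i j ∧
      koszulDiff F m M z = 0}
  have hT : Monotone T := fun D D' hD => Submodule.span_mono <| by
    rintro z ⟨i, j, hj, hz⟩
    exact ⟨i, j, by omega, hz⟩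
  obtain ⟨D, hD⟩ := monotone_stabilizes_iff_noetherian.2
    (inferInstance : IsNoetherian (MvPolynomial (Fin m) F) (Finset (Fin m) → M)) ⟨T, hT⟩
  refine ⟨D, fun i j hij c hc hdc => ?_⟩
  have hcT : c ∈ T D := by
    have hDj : D ≤ j.toNat := by omega
    have : T D = T j.toNat := hD _ hDj
    rw [this]
    exact Submodule.subset_span ⟨i, j, by omega, hc, hdc⟩
  -- in degree `j > D` only the multiples of the generating cycles by forms of positive degree occur
  have key : ∀ y ∈ T D, h.koszulProj i j y ∈ LinearMap.range (koszulDiff F m M) := by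
    intro y hy
    induction hy using Submodule.closure_induction with
    | zero => rw [map_zero]; exact Submodule.zero_mem _
    | add x y _ _ hx hy => rw [map_add]; exact Submodule.add_mem _ hx hy
    | smul_mem p z hz =>
      obtain ⟨i', j', hj', hz, hdz⟩ := hz
      rw [← p.sum_homogeneousComponent, Finset.sum_smul, map_sum]
      refine Submodule.sum_mem _ fun a _ => ?_
      have hp := homogeneousComponent_isHomogeneous a p
      have hmem : homogeneousComponent a p • z ∈ koszulChains m ℳ i' (j' + a) := by
        rw [mem_koszulChains] at hz ⊢
        refine fun A => ⟨fun hA => ?_, fun hA => ?_⟩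
        · have := h.smul_mem a _ _ _ hp ((hz A).1 hA)
          rwa [show (a : ℤ) + (j' - i') = j' + a - i' by ring] at this
        · rw [Pi.smul_apply, (hz A).2 hA, smul_zero]
      rw [h.koszulProj_of_mem i j hmem]
      split_ifs with hij'
      · obtain ⟨b, rfl⟩ : ∃ b, a = b + 1 := ⟨a - 1, by omega⟩
        exact smul_mem_range_koszulDiff hdz hp
      · exact Submodule.zero_mem _
  obtain ⟨b, hb⟩ := key c hcT
  refine ⟨h.koszulProj (i + 1) j b, h.koszulProj_mem _ _ _, ?_⟩
  rw [h.koszulDiff_koszulProj, hb]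
  rw [h.koszulProj_of_mem i j (h.koszulProj_mem i j c), if_pos ⟨rfl, rfl⟩,
    h.koszulProj_of_mem i j hc, if_pos ⟨rfl, rfl⟩]

end IsGradedModule

end Koszul

/-! ### Powers of an ideal generated by forms of one degree -/

section Powers

variable {F : Type*} [Field F] {m : ℕ} {M : Type*} [AddCommGroup M]
  [Module (MvPolynomial (Fin m) F) M] {ℳ : ℤ → AddSubgroup M}

namespace IsGradedModule

variable {G : Set (MvPolynomial (Fin m) F)} {d : ℕ}

theorem proj_mem_closure_of_mem_smul (h : IsGradedModule F m ℳ)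
    (hG : ∀ g ∈ G, g.IsHomogeneous d) {N : Submodule (MvPolynomial (Fin m) F) M}
    (hN : h.IsHomogeneous N) {x : M} (hx : x ∈ Ideal.span G • N) (j : ℤ) :
    h.proj j x ∈ AddSubgroup.closure {z | ∃ g ∈ G, ∃ y ∈ N, y ∈ ℳ (j - d) ∧ z = g • y} := by
  refine Submodule.smul_induction_on hx ?_ ?_
  · intro r hr
    induction hr using Submodule.span_induction with
    | mem g hg =>
      intro y hy
      rw [h.proj_smul (hG g hg)]
      exact AddSubgroup.subset_closure ⟨g, hg, _, hN y hy _, h.proj_mem _ _, rfl⟩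
    | zero => intro y _; rw [zero_smul, map_zero]; exact zero_mem _
    | add r s _ _ hr hs => intro y hy; rw [add_smul, map_add]; exact add_mem (hr y hy) (hs y hy)
    | smul q r _ hr =>
      intro y hy
      rw [smul_eq_mul, mul_comm, mul_smul]
      exact hr _ (N.smul_mem q hy)
  · intro x y hx hy
    rw [map_add]
    exact add_mem hx hy

theorem IsHomogeneous.span_smul {h : IsGradedModule F m ℳ}
    (hG : ∀ g ∈ G, g.IsHomogeneous d) {N : Submodule (MvPolynomial (Fin m) F) M}
    (hN : h.IsHomogeneous N) : h.IsHomogeneous (Ideal.span G • N) := by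
  intro x hx j
  refine (AddSubgroup.closure_le (Ideal.span G • N).toAddSubgroup).2 ?_
    (h.proj_mem_closure_of_mem_smul hG hN hx j)
  rintro _ ⟨g, hg, y, hy, -, rfl⟩
  exact Submodule.smul_mem_smul (Ideal.subset_span hg) hy

theorem pow_succ_smul_top (I : Ideal (MvPolynomial (Fin m) F)) (t : ℕ) :
    (I ^ (t + 1) • ⊤ : Submodule (MvPolynomial (Fin m) F) M) = I • (I ^ t • ⊤) := by
  rw [pow_succ', Submodule.mul_smul]

theorem isHomogeneous_pow_smul_top (h : IsGradedModule F m ℳ)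
    (hG : ∀ g ∈ G, g.IsHomogeneous d) (t : ℕ) :
    h.IsHomogeneous (Ideal.span G ^ t • ⊤) := by
  induction t with
  | zero => intro x _ j; simp
  | succ t ih => rw [pow_succ_smul_top]; exact ih.span_smul hG

/-- If `M` is generated in degree `0`, the submodule `I ^ t • M` starts in degree `d t`. -/
theorem eq_zero_of_mem_pow_smul_top (h : IsGradedModule F m ℳ)
    (hgen : Submodule.span (MvPolynomial (Fin m) F) (ℳ 0 : Set M) = ⊤)
    (hG : ∀ g ∈ G, g.IsHomogeneous d) (t : ℕ) {j : ℤ} (hj : j < d * t) {x : M}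
    (hx : x ∈ (Ideal.span G ^ t • ⊤ : Submodule (MvPolynomial (Fin m) F) M)) (hxj : x ∈ ℳ j) :
    x = 0 := by
  induction t generalizing j x with
  | zero =>
    rw [← h.proj_eq_self hxj]
    exact h.proj_eq_zero_of_neg hgen (by simpa using hj) x
  | succ t ih =>
    rw [pow_succ_smul_top] at hx
    have := h.proj_mem_closure_of_mem_smul hG (h.isHomogeneous_pow_smul_top hG t) hx j
    rw [h.proj_eq_self hxj] at this
    rw [← AddSubgroup.mem_bot]
    refine (AddSubgroup.closure_le ⊥).2 ?_ this
    rintro _ ⟨g, -, y, hy, hyj, rfl⟩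
    have hy0 : y = 0 := ih (by push_cast at hj; linarith) hy hyj
    simp [hy0]

/-- If `M_{dt+a} ⊆ I ^ t M` with `t ≥ 1` then `M_{d(t+1)+a} = I_d M_{dt+a} ⊆ I ^ (t+1) M`. -/
theorem le_pow_succ_smul_top (h : IsGradedModule F m ℳ)
    (hgen : Submodule.span (MvPolynomial (Fin m) F) (ℳ 0 : Set M) = ⊤)
    (hG : ∀ g ∈ G, g.IsHomogeneous d) {t a : ℕ} (ht : 1 ≤ t)
    (hta : ∀ x ∈ ℳ ((d * t + a : ℕ) : ℤ),
      x ∈ (Ideal.span G ^ t • ⊤ : Submodule (MvPolynomial (Fin m) F) M)) :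
    ∀ x ∈ ℳ ((d * (t + 1) + a : ℕ) : ℤ),
      x ∈ (Ideal.span G ^ (t + 1) • ⊤ : Submodule (MvPolynomial (Fin m) F) M) := by
  intro x hx
  have hle : (Ideal.span G ^ t • ⊤ : Submodule (MvPolynomial (Fin m) F) M)
      ≤ Ideal.span G • ⊤ :=
    Submodule.smul_mono_left (Ideal.pow_le_self (by omega))
  have hxI : x ∈ (Ideal.span G • ⊤ : Submodule (MvPolynomial (Fin m) F) M) :=
    h.le_of_le hgen (by rw [mul_add]; omega) (fun x hx => hle (hta x hx)) x hx
  have := h.proj_mem_closure_of_mem_smul hG (N := ⊤) (fun _ _ _ => Submodule.mem_top) hxI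
    ((d * (t + 1) + a : ℕ) : ℤ)
  rw [h.proj_eq_self hx] at this
  refine (AddSubgroup.closure_le (Ideal.span G ^ (t + 1) • ⊤ :
    Submodule (MvPolynomial (Fin m) F) M).toAddSubgroup).2 ?_ this
  rintro _ ⟨g, hg, y, -, hy, rfl⟩
  change g • y ∈ (Ideal.span G ^ (t + 1) • ⊤ : Submodule (MvPolynomial (Fin m) F) M)
  rw [pow_succ_smul_top]
  refine Submodule.smul_mem_smul (Ideal.subset_span hg) (hta y ?_)
  rwa [show (((d * (t + 1) + a : ℕ) : ℤ) - d) = ((d * t + a : ℕ) : ℤ) by push_cast; ring] at hy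

/-- The numbers `f t`, for which `d t + f t` is the first degree in which `M` and `I ^ t M`
agree. -/
theorem exists_agreement_degrees (h : IsGradedModule F m ℳ)
    (hgen : Submodule.span (MvPolynomial (Fin m) F) (ℳ 0 : Set M) = ⊤)
    (hG : ∀ g ∈ G, g.IsHomogeneous d) (hd : 0 < d) (hne : ∀ j : ℕ, ℳ j ≠ ⊥)
    (hJ : ∃ J : ℕ, ∀ x ∈ ℳ J, x ∈ (Ideal.span G • ⊤ : Submodule (MvPolynomial (Fin m) F) M)) :
    ∃ f : ℕ → ℕ, ∀ t, 1 ≤ t → f (t + 1) ≤ f t ∧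
      (∀ j : ℤ, d * t + f t ≤ j → ∀ x ∈ ℳ j,
        x ∈ (Ideal.span G ^ t • ⊤ : Submodule (MvPolynomial (Fin m) F) M)) ∧
      ∃ x ∈ ℳ (d * t + f t - 1),
        x ∉ (Ideal.span G ^ t • ⊤ : Submodule (MvPolynomial (Fin m) F) M) := by
  obtain ⟨J, hJ⟩ := hJ
  let S : ℕ → Set ℕ := fun t => {a | ∀ x ∈ ℳ ((d * t + a : ℕ) : ℤ),
    x ∈ (Ideal.span G ^ t • ⊤ : Submodule (MvPolynomial (Fin m) F) M)}
  have hSsucc : ∀ t a, 1 ≤ t → a ∈ S t → a ∈ S (t + 1) := fun t a ht ha =>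
    h.le_pow_succ_smul_top hgen hG ht ha
  have hSJ : ∀ t, 1 ≤ t → J ∈ S t := by
    intro t ht
    induction t, ht using Nat.le_induction with
    | base =>
      intro x hx
      rw [pow_one]
      exact h.le_of_le hgen (by omega) hJ x hx
    | succ t ht ih => exact hSsucc t J ht ih
  refine ⟨fun t => sInf (S t), fun t ht => ⟨?_, ?_, ?_⟩⟩
  · exact Nat.sInf_le (hSsucc t _ ht (Nat.sInf_mem ⟨J, hSJ t ht⟩))
  · intro j hj
    lift j to ℕ using (by positivity : (0 : ℤ) ≤ d * t + (sInf (S t) : ℕ)).trans hj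
    exact h.le_of_le hgen (by exact_mod_cast hj) (Nat.sInf_mem ⟨J, hSJ t ht⟩)
  · rcases Nat.eq_zero_or_pos (sInf (S t)) with h0 | hpos
    · -- in degree `d t - 1` the module `M` is nonzero and `I ^ t M` is zero
      have hdt : 0 < d * t := Nat.mul_pos hd ht
      obtain ⟨x, hx, hx0⟩ :=
        (AddSubgroup.bot_or_exists_ne_zero (ℳ ((d * t - 1 : ℕ) : ℤ))).resolve_left (hne _)
      refine ⟨x, ?_, fun hxI => hx0 ?_⟩
      · convert hx using 2
        simp only [h0]
        omega
      · exact h.eq_zero_of_mem_pow_smul_top hgen hG t (by push_cast [hdt]; omega) hxI hx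
    · have : sInf (S t) - 1 ∉ S t := Nat.notMem_of_lt_sInf (by omega)
      by_contra! hall
      refine this fun x hx => hall x ?_
      convert hx using 2
      push_cast [hpos]; ring

/-! ### Regularity of submodules with bounded quotient -/

theorem quotGrading_eq_bot_iff {N : Submodule (MvPolynomial (Fin m) F) M} {j : ℤ} :
    quotGrading ℳ N j = ⊥ ↔ ∀ x ∈ ℳ j, x ∈ N := by
  rw [AddSubgroup.eq_bot_iff_forall]
  constructor
  · intro h x hx
    exact (Submodule.Quotient.mk_eq_zero N).1 (h _ ⟨x, hx, rfl⟩)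
  · rintro h _ ⟨x, hx, rfl⟩
    exact (Submodule.Quotient.mk_eq_zero N).2 (h x hx)

theorem not_torVanishes_of_top (hX : ∀ (k : Fin m) (j : ℤ) (x : M), x ∈ ℳ j →
      (X k : MvPolynomial (Fin m) F) • x ∈ ℳ (j + 1)) {r : ℤ} (hr : ℳ r ≠ ⊥)
    (hr' : ℳ (r + 1) = ⊥) : ¬ TorVanishes F m ℳ m (r + m) := by
  obtain ⟨x, hx, hx0⟩ := (AddSubgroup.bot_or_exists_ne_zero (ℳ r)).resolve_left hr
  refine not_torVanishes_of_socle hx hx0 fun k => ?_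
  have := hX k r x hx
  rwa [hr', AddSubgroup.mem_bot] at this

/-- The regularity of a module with a top degree is that degree. -/
theorem regularityLE_iff_of_top (hX : ∀ (k : Fin m) (j : ℤ) (x : M), x ∈ ℳ j →
      (X k : MvPolynomial (Fin m) F) • x ∈ ℳ (j + 1)) {r : ℤ} (hr : ℳ r ≠ ⊥)
    (hr' : ∀ j, r < j → ℳ j = ⊥) (s : ℤ) : RegularityLE F m ℳ s ↔ r ≤ s := by
  constructor
  · intro hs
    by_contra! hlt
    exact not_torVanishes_of_top hX hr (hr' _ (by omega)) (hs m (r + m) (by omega))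
  · exact fun hrs i j hij => torVanishes_of_eq_bot (hr' _ (by omega))

/-- If `M` has no socle and `M ⧸ N` has top degree `s`, then
`reg N = max (reg M) (s + 1)`. -/
theorem regularityLE_subGrading_iff (h : IsGradedModule F m ℳ) (hm : 0 < m)
    (hsoc : ∀ j, ∀ x ∈ ℳ j, (∀ k : Fin m, (X k : MvPolynomial (Fin m) F) • x = 0) → x = 0)
    {N : Submodule (MvPolynomial (Fin m) F) M} {s : ℤ} (hs : quotGrading ℳ N s ≠ ⊥)
    (hs' : ∀ j, s < j → quotGrading ℳ N j = ⊥) (r : ℤ) :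
    RegularityLE F m (subGrading ℳ N) r ↔ RegularityLE F m ℳ r ∧ s + 1 ≤ r := by
  have hE := gradedShortExact_mkQ h N
  have hX : ∀ (k : Fin m) (j : ℤ) (x : M ⧸ N), x ∈ quotGrading ℳ N j →
      (X k : MvPolynomial (Fin m) F) • x ∈ quotGrading ℳ N (j + 1) := by
    rintro k j _ ⟨x, hx, rfl⟩
    exact ⟨_, h.X_smul_mem k hx, map_smul N.mkQ _ x⟩
  have htop := regularityLE_iff_of_top hX hs hs'
  constructor
  · intro hr
    have hsr : s + 1 ≤ r := by
      by_contra! hlt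
      obtain ⟨i, rfl⟩ : ∃ i, m = i + 1 := ⟨m - 1, by omega⟩
      -- `Tor_m(M)` vanishes in degree `s + m`, so `Tor_m(M ⧸ N)` embeds into `Tor_{m-1}(N)`
      exact not_torVanishes_of_top hX hs (hs' _ (by omega))
        (hE.torVanishes_right (torVanishes_of_socle_eq_zero (hsoc s))
          (hr i _ (by push_cast; omega)))
    exact ⟨hE.regularityLE_middle hr ((htop r).2 (by omega)), hsr⟩
  · rintro ⟨hr, hsr⟩
    exact hE.regularityLE_left hr ((htop _).2 (by omega))

/-- If `K` lives in bounded degrees, then the regularity of a submodule `P` is the maximum of the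
top degree of `K ⊓ P` and of the regularity of the image of `P` in `M ⧸ K`. -/
theorem regularityLE_subGrading_iff_of_degreeLE (h : IsGradedModule F m ℳ)
    {K P : Submodule (MvPolynomial (Fin m) F) M} {Q : Submodule (MvPolynomial (Fin m) F) (M ⧸ K)}
    (hK : h.IsHomogeneous K) (hP : h.IsHomogeneous P) (hQ : P.map K.mkQ = Q) {D : ℤ}
    (hD : DegreeLE ℳ K D) (r : ℤ) :
    RegularityLE F m (subGrading ℳ P) r ↔
      DegreeLE ℳ (K ⊓ P) r ∧ RegularityLE F m (subGrading (quotGrading ℳ K) Q) r := by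
  have hE := gradedShortExact_restrict h hK hP hQ
  have hdeg : ∀ r, DegreeLE ℳ (K ⊓ P) r → RegularityLE F m (subGrading ℳ (K ⊓ P)) r :=
    fun r hr i j hij => torVanishes_of_eq_bot <| (AddSubgroup.eq_bot_iff_forall _).2
      fun x hx => Subtype.ext (hr _ hij x.1 x.2 hx)
  constructor
  · intro hr
    have hKP : DegreeLE ℳ (K ⊓ P) r := by
      -- descending induction on the degree: a nonzero element of top degree is in the socle of `P`
      have key : ∀ (n : ℕ) (j : ℤ), D - n < j → r < j → ∀ x ∈ K ⊓ P, x ∈ ℳ j → x = 0 := by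
        intro n
        induction n with
        | zero => exact fun j hj _ x hx hxj => hD j (by simpa using hj) x hx.1 hxj
        | succ n ih =>
          intro j hj hrj x hx hxj
          by_contra hx0
          refine not_torVanishes_of_socle (F := F) (ℳ := subGrading ℳ P) (x := ⟨x, hx.2⟩) hxj
            (fun h0 => hx0 (congrArg Subtype.val h0)) (fun k => Subtype.ext ?_)
            (hr m (j + m) (by omega))
          exact ih (j + 1) (by push_cast at hj; omega) (by omega) _
            (Submodule.smul_mem _ _ hx) (h.X_smul_mem k hxj)
      exact fun j hj => key (D - j + 1).toNat j (by omega) hj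
    exact ⟨hKP, hE.regularityLE_right hr ((hdeg r hKP).mono (by omega))⟩
  · rintro ⟨hKP, hQr⟩
    exact hE.regularityLE_middle (hdeg r hKP) hQr

end IsGradedModule

end Powers

theorem mainTheorem4 {F : Type*} [Field F] (n : ℕ) {M : Type*} [AddCommGroup M]
    [Module (MvPolynomial (Fin (n + 1)) F) M]
    [Module.Finite (MvPolynomial (Fin (n + 1)) F) M]
    (ℳ : ℤ → AddSubgroup M)
    (hM : IsGradedModule F (n + 1) ℳ)
    (hgen : Submodule.span (MvPolynomial (Fin (n + 1)) F) (ℳ 0 : Set M) = ⊤)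
    (I : Ideal (MvPolynomial (Fin (n + 1)) F)) (d : ℕ) (hd : 0 < d)
    (hI : ∃ G : Set (MvPolynomial (Fin (n + 1)) F),
      (∀ g ∈ G, g.IsHomogeneous d) ∧ I = Ideal.span G)
    (hfin : IsFiniteLength (MvPolynomial (Fin (n + 1)) F)
      (M ⧸ (I • ⊤ : Submodule (MvPolynomial (Fin (n + 1)) F) M)))
    (hinf : ¬ IsFiniteLength (MvPolynomial (Fin (n + 1)) F) M) :
    ∃ f e : ℕ → ℤ,
      (∀ t : ℕ, 1 ≤ t →
        regularity F (n + 1)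
            (quotGrading ℳ (I ^ t • ⊤ : Submodule (MvPolynomial (Fin (n + 1)) F) M))
          = (((d * t + f t - 1 : ℤ) : ℝ) : EReal)
        ∧ f (t + 1) ≤ f t ∧ 0 ≤ f t) ∧
      (∀ t : ℕ, 1 ≤ t →
        regularity F (n + 1)
            (subGrading ℳ (I ^ t • ⊤ : Submodule (MvPolynomial (Fin (n + 1)) F) M))
          = (((d * t + e t : ℤ) : ℝ) : EReal)
        ∧ e (t + 1) ≤ e t ∧ 0 ≤ e t) ∧
      ∃ ε : ℤ,
        IsGLB (e '' Set.Ici 1) ε ∧ IsGLB (f '' Set.Ici 1) ε ∧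
        ∀ᶠ t : ℕ in Filter.atTop,
          regularity F (n + 1)
              (subGrading ℳ (I ^ t • ⊤ : Submodule (MvPolynomial (Fin (n + 1)) F) M))
            = (((d * t + ε : ℤ) : ℝ) : EReal) := by
  obtain ⟨G, hG, rfl⟩ := hI
  obtain ⟨K, D, hK, hD, hsoc⟩ := hM.exists_degreeLE_maximal
  have hM' := hM.quot hK
  have hgen' : Submodule.span (MvPolynomial (Fin (n + 1)) F)
      (quotGrading ℳ K 0 : Set (M ⧸ K)) = ⊤ := by
    have : (quotGrading ℳ K 0 : Set (M ⧸ K)) = K.mkQ '' (ℳ 0) := rfl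
    rw [this, ← Submodule.map_span, hgen, Submodule.map_top, Submodule.range_mkQ]
  have hmap : ∀ t, (Ideal.span G ^ t • ⊤ : Submodule (MvPolynomial (Fin (n + 1)) F) M).map K.mkQ
      = Ideal.span G ^ t • ⊤ := fun t => by
    rw [Submodule.map_smul'', Submodule.map_top, Submodule.range_mkQ]
  have hhom := hM.isHomogeneous_pow_smul_top hG
  have hne : ∀ j : ℕ, ℳ j ≠ ⊥ := fun j hj => hinf (hM.isFiniteLength_of_eq_bot hgen hj)
  have hne' : ∀ j : ℕ, quotGrading ℳ K j ≠ ⊥ := by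
    intro b hb
    rw [IsGradedModule.quotGrading_eq_bot_iff] at hb
    refine hne (max b (D + 1).toNat) ((AddSubgroup.eq_bot_iff_forall _).2 fun x hx => ?_)
    exact hD _ (by omega) x (hM.le_of_le hgen (le_max_left _ _) hb x hx) hx
  have hJ : ∃ J : ℕ, ∀ x ∈ ℳ J,
      x ∈ (Ideal.span G • ⊤ : Submodule (MvPolynomial (Fin (n + 1)) F) M) := by
    have hhom1 := hhom 1
    rw [pow_one] at hhom1
    obtain ⟨J, hJ⟩ := (hM.quot hhom1).eq_bot_of_isFiniteLength hfin
    exact ⟨J, IsGradedModule.quotGrading_eq_bot_iff.1 (hJ J le_rfl)⟩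
  have hJ' : ∃ J : ℕ, ∀ x ∈ quotGrading ℳ K J,
      x ∈ (Ideal.span G • ⊤ : Submodule (MvPolynomial (Fin (n + 1)) F) (M ⧸ K)) := by
    obtain ⟨J, hJ⟩ := hJ
    refine ⟨J, ?_⟩
    rintro _ ⟨x, hx, rfl⟩
    have := hmap 1
    rw [pow_one] at this
    rw [← this]
    exact Submodule.mem_map_of_mem (hJ x hx)
  obtain ⟨f, hf⟩ := hM.exists_agreement_degrees hgen hG hd hne hJ
  obtain ⟨f', hf'⟩ := hM'.exists_agreement_degrees hgen' hG hd hne' hJ'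
  obtain ⟨r₀, hr₀⟩ := hM'.exists_regularityLE
  have hsoc' : ∀ j, ∀ x ∈ quotGrading ℳ K j,
      (∀ k, (X k : MvPolynomial (Fin (n + 1)) F) • x = 0) → x = 0 := by
    rintro j _ ⟨x, hx, rfl⟩ hX
    refine (Submodule.Quotient.mk_eq_zero K).2 (hsoc j x hx fun k => ?_)
    exact (Submodule.Quotient.mk_eq_zero K).1 (hX k)
  have hregQ : ∀ t : ℕ, 1 ≤ t → ∀ s, RegularityLE F (n + 1) (quotGrading ℳ
      (Ideal.span G ^ t • ⊤ : Submodule (MvPolynomial (Fin (n + 1)) F) M)) s ↔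
        (d * t + f t - 1 : ℤ) ≤ s := by
    intro t ht
    obtain ⟨-, h1, x, hx, hxI⟩ := hf t ht
    refine IsGradedModule.regularityLE_iff_of_top
      (fun k j x hx => (hM.quot (hhom t)).X_smul_mem k hx) ?_ fun j hj => ?_
    · exact fun h => hxI (IsGradedModule.quotGrading_eq_bot_iff.1 h x hx)
    · exact IsGradedModule.quotGrading_eq_bot_iff.2 (h1 j (by omega))
  -- `reg (I ^ t M)` is the maximum of the top degree of `K ⊓ I ^ t M`, of `reg (M ⧸ K)`, and of
  -- the first degree in which `M ⧸ K` and its submodule `I ^ t (M ⧸ K)` agree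
  have hregI : ∀ t : ℕ, 1 ≤ t → ∀ s, RegularityLE F (n + 1) (subGrading ℳ
      (Ideal.span G ^ t • ⊤ : Submodule (MvPolynomial (Fin (n + 1)) F) M)) s ↔
        IsGradedModule.DegreeLE ℳ (K ⊓ Ideal.span G ^ t • ⊤) s ∧
          RegularityLE F (n + 1) (quotGrading ℳ K) s ∧ (d * t + f' t : ℤ) ≤ s := by
    intro t ht s
    obtain ⟨-, h1, x, hx, hxI⟩ := hf' t ht
    rw [hM.regularityLE_subGrading_iff_of_degreeLE hK (hhom t) (hmap t) hD,
      hM'.regularityLE_subGrading_iff n.succ_pos hsoc' (s := d * t + f' t - 1)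
        (fun h => hxI (IsGradedModule.quotGrading_eq_bot_iff.1 h x hx))
        (fun j hj => IsGradedModule.quotGrading_eq_bot_iff.2 (h1 j (by omega))), sub_add_cancel]
  have hDt : ∀ (t : ℕ) (s : ℤ), D ≤ s →
      IsGradedModule.DegreeLE ℳ (K ⊓ Ideal.span G ^ t • ⊤) s :=
    fun t s hs j hj x hx => hD j (by omega) x hx.1
  have hexists : ∀ t : ℕ, ∃ e : ℤ, 1 ≤ t → ∀ s, RegularityLE F (n + 1) (subGrading ℳ
      (Ideal.span G ^ t • ⊤ : Submodule (MvPolynomial (Fin (n + 1)) F) M)) s ↔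
        (d * t + e : ℤ) ≤ s := by
    intro t
    by_cases ht : 1 ≤ t
    · obtain ⟨r, hr, hmin⟩ := Int.exists_least_of_bdd
        (P := RegularityLE F (n + 1) (subGrading ℳ
          (Ideal.span G ^ t • ⊤ : Submodule (MvPolynomial (Fin (n + 1)) F) M)))
        ⟨d * t + f' t, fun s hs => ((hregI t ht s).1 hs).2.2⟩
        ⟨max (max D r₀) (d * t + f' t), (hregI t ht _).2 ⟨hDt t _ (by simp), hr₀.mono (by simp),
          by simp⟩⟩
      refine ⟨r - d * t, fun _ s => ⟨fun hs => by linarith [hmin s hs], fun hs => ?_⟩⟩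
      exact RegularityLE.mono hr (by linarith)
    · exact ⟨0, fun h => absurd h ht⟩
  choose e he using hexists
  have hef : ∀ t, 1 ≤ t → (f' t : ℤ) ≤ e t := fun t ht => by
    have := ((hregI t ht _).1 ((he t ht _).2 le_rfl)).2.2
    omega
  have he_succ : ∀ t, 1 ≤ t → e (t + 1) ≤ e t := by
    intro t ht
    obtain ⟨h1, h2, h3⟩ := (hregI t ht _).1 ((he t ht _).2 le_rfl)
    have hle : (d * t + e t : ℤ) ≤ d * (t + 1 : ℕ) + e t := by
      push_cast
      nlinarith
    have := (he (t + 1) (by omega) (d * (t + 1 : ℕ) + e t)).1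
      ((hregI (t + 1) (by omega) _).2 ⟨fun j hj x hx => h1 j (by omega) x
        ⟨hx.1, Submodule.smul_mono_left (Ideal.pow_le_pow_right t.le_succ) hx.2⟩, h2.mono hle, ?_⟩)
    · omega
    · have := (hf' t ht).1
      have := hef t ht
      omega
  have hff : ∀ t, 1 ≤ t → f' t ≤ f t := by
    intro t ht
    obtain ⟨-, -, x, hx, hxI⟩ := hf' t ht
    by_contra! hlt
    obtain ⟨y, hy, rfl⟩ := hx
    refine hxI ?_
    rw [← hmap t]
    exact Submodule.mem_map_of_mem ((hf t ht).2.1 _ (by omega) y hy)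
  -- once `d t` exceeds `reg (M ⧸ K)` and the top degree of `K`, the three sequences agree
  have hlarge : ∀ t : ℕ, 1 ≤ t → max (D + 1) r₀ < d * t → e t = f' t ∧ f t = f' t := by
    intro t ht hlt
    constructor
    · refine le_antisymm ?_ (hef t ht)
      have := (he t ht (d * t + f' t)).1
        ((hregI t ht _).2 ⟨hDt t _ (by omega), hr₀.mono (by omega), le_rfl⟩)
      omega
    · refine le_antisymm ?_ (hff t ht)
      by_contra! hlt'
      obtain ⟨-, -, x, hx, hxI⟩ := hf t ht
      refine hxI ?_
      have hxK := (hf' t ht).2.1 _ (by omega : (d * t + f' t : ℤ) ≤ d * t + f t - 1) (K.mkQ x)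
        ⟨x, hx, rfl⟩
      rw [← hmap t] at hxK
      obtain ⟨y, hy, hyx⟩ := hxK
      have hyx' : y - x ∈ K := (Submodule.Quotient.eq K).1 hyx
      have h0 := hD _ (by omega) _ (hK _ hyx' (d * t + f t - 1)) (hM.proj_mem _ _)
      rw [map_sub, hM.proj_eq_self hx, sub_eq_zero] at h0
      rw [← h0]
      exact hhom t y hy _
  have hf'anti : ∀ s t, 1 ≤ s → s ≤ t → f' t ≤ f' s := by
    intro s t hs hst
    induction t, hst using Nat.le_induction with
    | base => exact le_rfl
    | succ t ht ih => exact (hf' t (by omega)).1.trans ih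
  obtain ⟨t₁, ht₁, hmin⟩ : ∃ t₁, 1 ≤ t₁ ∧ ∀ t, 1 ≤ t → f' t₁ ≤ f' t := by
    obtain ⟨t₁, ht₁, h⟩ := exists_minimalFor_of_wellFoundedLT (fun t => 1 ≤ t) f' ⟨1, le_rfl⟩
    exact ⟨t₁, ht₁, fun t ht => (le_total (f' t₁) (f' t)).elim id (h ht)⟩
  have hevent : ∀ t : ℕ, t₁ + (max (D + 1) r₀).toNat + 1 ≤ t →
      1 ≤ t ∧ e t = f' t₁ ∧ f t = f' t₁ := by
    intro t ht
    have h1 : 1 ≤ t := by omega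
    have hdt : (t : ℤ) ≤ d * t := by exact_mod_cast Nat.le_mul_of_pos_left t hd
    obtain ⟨h2, h3⟩ := hlarge t h1 (by omega)
    have h4 : f' t = f' t₁ := le_antisymm (hf'anti _ _ ht₁ (by omega)) (hmin t h1)
    exact ⟨h1, by rw [h2, h4], by rw [h3, h4]⟩
  refine ⟨fun t => f t, e, fun t ht => ⟨?_, ?_, ?_⟩, fun t ht => ⟨?_, he_succ t ht, ?_⟩, f' t₁,
    ?_, ?_, ?_⟩
  · exact_mod_cast regularity_eq_intCast (hregQ t ht)
  · exact Int.ofNat_le.2 (hf t ht).1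
  · positivity
  · exact_mod_cast regularity_eq_intCast (he t ht)
  · exact (Int.natCast_nonneg _).trans (hef t ht)
  · refine IsLeast.isGLB ⟨?_, ?_⟩
    · obtain ⟨h1, h2, -⟩ := hevent _ le_rfl
      exact ⟨_, h1, h2⟩
    · rintro _ ⟨t, ht, rfl⟩
      exact (Int.ofNat_le.2 (hmin t ht)).trans (hef t ht)
  · refine IsLeast.isGLB ⟨?_, ?_⟩
    · obtain ⟨h1, -, h2⟩ := hevent _ le_rfl
      exact ⟨_, h1, congrArg Nat.cast h2⟩
    · rintro _ ⟨t, ht, rfl⟩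
      exact Int.ofNat_le.2 ((hmin t ht).trans (hff t ht))
  · refine Filter.eventually_atTop.2 ⟨t₁ + (max (D + 1) r₀).toNat + 1, fun t ht => ?_⟩
    obtain ⟨h1, h2, -⟩ := hevent t ht
    rw [← h2]
    exact_mod_cast regularity_eq_intCast (he t h1)
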